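/- A binary memoryless symmetric (BMS) channel is a channel $P$ from $\{\pm1\}$ to a measurable space $\mathcal Y$ for which some measurable involution $\tau$ of $\mathcal Y$ satisfies $P(\tau^{-1}(E)\mid +)=P(E\mid -)$ for all measurable $E$. Its $\Delta$-component is the $[0,\frac12]$-valued random variable $\Delta$ given by the smaller of the two posterior probabilities of the input given the output, when the input is uniform (so that $P$ is equivalent to observing $\Delta$ and the output of a binary symmetric channel with crossover probability $\Delta$). Put $$P_e(P)=\mathbb E\,\Delta,\quad C(P)=\mathbb E[\log 2+\Delta\log\Delta+(1-\Delta)\log(1-\Delta)],\quad Z(P)=\mathbb E\big[2\sqrt{\Delta(1-\Delta)}\big].$$ Let $T$ be either the rooted $d$-regular tree in which every vertex has exactly $d\ge 1$ children ($d$ an integer), or a Galton--Watson tree with $\mathrm{Poisson}(d)$ offspring distribution ($d>0$ real), with root $\rho$. Let $\sigma_\rho$ be uniform on $\{\pm1\}$ and let it be broadcast down the tree, each edge independently flipping the bit with probability $\delta\in(0,\frac12]$; put $\theta=1-2\delta$. Let $W$ be a BMS channel, and let each vertex $u$ carry an observation $\omega_u\sim W(\sigma_u)$, conditionally independent given all the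 bits and $T$. Let $L_k$ be the set of vertices at level $k$ and $T_k$ the set of vertices at levels $\le k$. Let $M_k$ be the channel $\sigma_\rho\to(\omega_{T_k},\sigma_{L_k})$ and $\tilde M_k$ the channel $\sigma_\rho\to\omega_{T_k}$ (in both, the tree up to level $k$ is observed), and let $P_{\Delta_k}$, $P_{\tilde\Delta_k}$ be the distributions of their $\Delta$-components. **Theorem 3.** Suppose that $P_e(W)\neq\frac12$ and $$d\theta^2\exp\Big(-\frac{(d\theta^2-1)_+}{2}\Big)Z(W)<1 ;$$ the latter holds in particular if $d\theta^2<1$ or $d\theta^2>\alpha^*$, where $\alpha^*\approx 3.513$ is the unique solution in $(1,\infty)$ of $\alpha\exp(-\frac{\alpha-1}{2})=1$. Then, as $k\to\infty$, $P_{\Delta_k}$ and $P_{\tilde\Delta_k}$ converge in distribution to the same probability distribution. In particular, the following limits exist and $$\lim_{k\to\infty}P_e(M_k)=\lim_{k\to\infty}P_e(\tilde M_k),\qquad \lim_{k\to\infty}C(M_k)=\lim_{k\to\infty}C(\tilde M_k).$$ -/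

import Mathlib

open MeasureTheory ProbabilityTheory Filter Topology

noncomputable section

namespace BOTS

/-! ### Binary-input channels

A channel with input alphabet `{±1}` and output space `Y` is a Markov kernel from `Bool` to `Y`;
`true` stands for `+1` and `false` for `-1`. -/

section Channels

variable {Y : Type*} [MeasurableSpace Y]

/-- The channel `P` is binary memoryless symmetric (BMS): a measurable involution of the output
space exchanges the two output laws. -/
def IsBMS (P : Kernel Bool Y) [IsMarkovKernel P] : Prop :=
  ∃ τ : Y → Y, Measurable τ ∧ Function.Involutive τ ∧ (P true).map τ = P false

/-- The law of the output of the channel when the input is a uniform random bit. -/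
def outputLaw (P : Kernel Bool Y) : Measure Y :=
  (2⁻¹ : ENNReal) • (P true + P false)

/-- The posterior probability that the input was `+1` given the output `y`, for a uniform input. -/
def posteriorPlus (P : Kernel Bool Y) (y : Y) : ℝ :=
  ((P true).rnDeriv (P true + P false) y).toReal

/-- The value of `Δ` as a function of the output `y`: the smaller of the two posterior
probabilities of the input. Given `y`, the input is the more likely sign with probability `1 - Δ`
and the other one with probability `Δ`, so the channel acts as a binary symmetric channel with
crossover probability `Δ ∈ [0, 1/2]`. -/
def deltaOf (P : Kernel Bool Y) (y : Y) : ℝ :=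
  min (posteriorPlus P y) (1 - posteriorPlus P y)

lemma measurable_deltaOf (P : Kernel Bool Y) : Measurable (deltaOf P) := by
  unfold deltaOf posteriorPlus
  fun_prop

instance (P : Kernel Bool Y) [IsMarkovKernel P] : IsProbabilityMeasure (outputLaw P) := by
  constructor
  simp only [outputLaw, Measure.smul_apply, Measure.add_apply, measure_univ, smul_eq_mul]
  rw [one_add_one_eq_two]
  exact ENNReal.inv_mul_cancel (by norm_num) (by norm_num)

/-- The distribution of the `Δ`-component of the channel `P`. -/
def deltaLaw (P : Kernel Bool Y) [IsMarkovKernel P] : ProbabilityMeasure ℝ :=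
  ⟨(outputLaw P).map (deltaOf P),
    Measure.isProbabilityMeasure_map (measurable_deltaOf P).aemeasurable⟩

/-- The probability of error `E[Δ]`. -/
def errorProb (P : Kernel Bool Y) [IsMarkovKernel P] : ℝ :=
  ∫ x, x ∂(deltaLaw P : Measure ℝ)

/-- The capacity `E[log 2 + Δ log Δ + (1 - Δ) log (1 - Δ)]`, with `0 log 0 = 0`. -/
def capacity (P : Kernel Bool Y) [IsMarkovKernel P] : ℝ :=
  ∫ x, (Real.log 2 + x * Real.log x + (1 - x) * Real.log (1 - x)) ∂(deltaLaw P : Measure ℝ)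

/-- The Bhattacharyya coefficient `E[2 √(Δ (1 - Δ))]`. -/
def bhattacharyya (P : Kernel Bool Y) [IsMarkovKernel P] : ℝ :=
  ∫ x, 2 * √(x * (1 - x)) ∂(deltaLaw P : Measure ℝ)

/-- The binary symmetric channel that flips its input with probability `δ`. -/
def bsc (δ : unitInterval) : Kernel Bool Bool :=
  Kernel.ofFunOfCountable fun s => bernoulliMeasure (!s) s δ

instance (δ : unitInterval) : IsMarkovKernel (bsc δ) :=
  ⟨fun s => inferInstanceAs (IsProbabilityMeasure (bernoulliMeasure (!s) s δ))⟩

end Channels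

/-! ### Rooted labelled trees truncated at a given level -/

/-- Rooted trees, truncated at level `k`, in which every node above level `k` has finitely many
children (listed in order) and a label in `A`, and every node at level `k` has a label in `B`.
A node above level `k` may have no children. -/
def LabTree.{u} (A B : Type u) : ℕ → Type u
  | 0 => B
  | k + 1 => A × (Σ n : ℕ, Fin n → LabTree A B k)

instance LabTree.instMeasurableSpace.{u} (A B : Type u) [MeasurableSpace A] [MeasurableSpace B] :
    (k : ℕ) → MeasurableSpace (LabTree A B k)
  | 0 => inferInstanceAs (MeasurableSpace B)
  | k + 1 =>
    let _ := LabTree.instMeasurableSpace A B k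
    inferInstanceAs (MeasurableSpace (A × (Σ n : ℕ, Fin n → LabTree A B k)))

/-- Relabelling: apply `f` to the labels above level `k` and `g` to the labels at level `k`,
keeping the tree. -/
def LabTree.map.{u, v} {A B : Type u} {A' B' : Type v} (f : A → A') (g : B → B') :
    (k : ℕ) → LabTree A B k → LabTree A' B' k
  | 0, b => g b
  | k + 1, (a, ⟨n, c⟩) => (f a, ⟨n, fun i => LabTree.map f g k (c i)⟩)

lemma LabTree.measurable_map.{u, v} {A B : Type u} {A' B' : Type v} [MeasurableSpace A] [MeasurableSpace B]
    [MeasurableSpace A'] [MeasurableSpace B'] {f : A → A'} {g : B → B'}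
    (hf : Measurable f) (hg : Measurable g) (k : ℕ) : Measurable (LabTree.map f g k) := by
  induction k with
  | zero => exact hg
  | succ k ih =>
    have h : Measurable (fun p : Σ n : ℕ, Fin n → LabTree A B k =>
        (⟨p.1, fun i => LabTree.map f g k (p.2 i)⟩ : Σ n : ℕ, Fin n → LabTree A' B' k)) := by
      intro t ht
      rw [MeasurableSpace.measurableSet_iInf] at ht ⊢
      intro n
      have h1 : Measurable (fun c : Fin n → LabTree A B k => fun i => LabTree.map f g k (c i)) :=
        measurable_pi_lambda _ fun i => ih.comp (measurable_pi_apply i)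
      exact h1 (ht n)
    exact (hf.comp measurable_fst).prodMk (h.comp measurable_snd)

/-! ### Broadcasting on trees with survey -/

section Model

variable {Y : Type*} [MeasurableSpace Y]

/-- Given the bit `s` of a node, the law of the family of the subtrees below its children: the
number `n` of children has law `N` and, given `n`, the `n` subtrees are independent, each with
law `κ s`. -/
def forest {S : Type*} [MeasurableSpace S] (N : Measure ℕ) (κ : Kernel Bool S) :
    Kernel Bool (Σ n : ℕ, Fin n → S) :=
  Kernel.ofFunOfCountable fun s =>
    N.bind fun n => (Measure.pi fun _ : Fin n => κ s).map (Sigma.mk n)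

instance {S : Type*} [MeasurableSpace S] (N : Measure ℕ) [IsProbabilityMeasure N]
    (κ : Kernel Bool S) [IsMarkovKernel κ] : IsMarkovKernel (forest N κ) := by
  refine ⟨fun s => ?_⟩
  change IsProbabilityMeasure (N.bind _)
  refine isProbabilityMeasure_bind (by fun_prop) (ae_of_all _ fun n => ?_)
  have hm : Measurable (fun c : Fin n → S => (⟨n, c⟩ : Σ m : ℕ, Fin m → S)) := by
    intro t ht
    exact (MeasurableSpace.measurableSet_iInf.1 ht) n
  exact Measure.isProbabilityMeasure_map hm.aemeasurable

/-- Broadcasting with survey on the random tree with offspring law `N`, truncated at level `k`.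
Every node `u` carries the label `(σ_u, ω_u)`. Given `σ_ρ = s`, the survey `ω_ρ` is the output of
`W` on the input `s`; independently of it, the root has `N`-distributed many children, the bit `s`
is sent to each child through an independent binary symmetric channel with flip probability `δ`,
and from the children on the process goes on in the same way, independently for different
children. -/
def broadcast (N : Measure ℕ) (δ : unitInterval) (W : Kernel Bool Y) :
    (k : ℕ) → Kernel Bool (LabTree (Bool × Y) (Bool × Y) k)
  | 0 => Kernel.prod Kernel.id W
  | k + 1 => Kernel.prod (Kernel.prod Kernel.id W) (forest N (broadcast N δ W k ∘ₖ bsc δ))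

instance (N : Measure ℕ) [IsProbabilityMeasure N] (δ : unitInterval) (W : Kernel Bool Y)
    [IsMarkovKernel W] (k : ℕ) : IsMarkovKernel (broadcast N δ W k) := by
  induction k with
  | zero => exact inferInstanceAs (IsMarkovKernel (Kernel.prod Kernel.id W))
  | succ k ih => exact inferInstanceAs (IsMarkovKernel
      (Kernel.prod (Kernel.prod Kernel.id W) (forest N (broadcast N δ W k ∘ₖ bsc δ))))

/-- The channel `σ_ρ → (ω_{T_k}, σ_{L_k})` (with the tree `T_k` observed): the surveys of all nodes
up to level `k` and the bits of the nodes at level `k`. -/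
def leafChannel (N : Measure ℕ) (δ : unitInterval) (W : Kernel Bool Y) (k : ℕ) :
    Kernel Bool (LabTree Y (Y × Bool) k) :=
  (broadcast N δ W k).map (LabTree.map Prod.snd Prod.swap k)

/-- The channel `σ_ρ → ω_{T_k}` (with the tree `T_k` observed): the surveys of all nodes up to
level `k`. -/
def surveyChannel (N : Measure ℕ) (δ : unitInterval) (W : Kernel Bool Y) (k : ℕ) :
    Kernel Bool (LabTree Y Y k) :=
  (broadcast N δ W k).map (LabTree.map Prod.snd Prod.snd k)

instance (N : Measure ℕ) [IsProbabilityMeasure N] (δ : unitInterval) (W : Kernel Bool Y)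
    [IsMarkovKernel W] (k : ℕ) : IsMarkovKernel (leafChannel N δ W k) :=
  Kernel.IsMarkovKernel.map _ (LabTree.measurable_map measurable_snd measurable_swap k)

instance (N : Measure ℕ) [IsProbabilityMeasure N] (δ : unitInterval) (W : Kernel Bool Y)
    [IsMarkovKernel W] (k : ℕ) : IsMarkovKernel (surveyChannel N δ W k) :=
  Kernel.IsMarkovKernel.map _ (LabTree.measurable_map measurable_snd measurable_snd k)

end Model

end BOTS

end

/-!
Let `X` be the posterior mean of the input given the output (`bias`), so that `Δ = (1 - |X|) / 2`.
All functionals of a channel that occur are means of functions of `X` (`biasMean`), and the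
Bhattacharyya coefficient is `Z = E √(1 - X²)`. A channel that is a function of another one has
smaller means of convex functions of `X` (`biasMean_map_le`, by the conditional Jensen inequality).
The survey channel is a function of the leaf channel, and of the survey channel one level deeper.

The heart of the argument is that the gap `D k = Z(survey) - Z(leaf) ≥ 0` at level `k` tends to `0`.
Both channels obey the same recursion (`treeStep`): the root observes its own survey and,
independently given its bit, the channels of its children through noisy edges. Since `Z` is
multiplicative over independent observations, `Z` at level `k + 1` is `Z(W) G(Z')`, where `G` is the
generating function of the offspring law and `Z'` is the coefficient of one child seen through an
edge. An edge replaces `X` by `θ X`, and `√(1 - θ² x²) - θ² √(1 - x²)` is convex, so an edge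
multiplies the gap by at most `θ²` (`affinity_comp_bsc_sub_le`). The slope of `G` on `[0, b]` is at
most `d exp (-c (1 - b))`, with `c = d - 1` for the regular tree and `c = d` for Poisson offspring
(`OffspringBound`), and for the survey channel `1 - Z' ≥ w / 2` with `w = θ² E X²`.

To bound `w` from below, the sum of the posterior means given the single subtrees is used as an
estimator of the root bit; the Cauchy-Schwarz inequality turns it into
`w (k + 1) ≥ d θ² w k / (1 + c w k)` (`sq_mul_sq_le_biasMean_forest`). The second moment of `W` is
positive because its error probability is not `1/2`, and hence the lower limit of `c w k` is
at least `(d θ² - 1)₊` (`exists_tendsto_le_mul`). So `D (k + 1) ≤ r k * D k` with `r k` tending to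
`d θ² exp (-(d θ² - 1)₊ / 2) Z(W) < 1`, and `D` tends to `0` (`tendsto_affinity_sub`).

A suitable multiple of `-√(1 - x²)`, minus `x ^ m`, is convex, so `D` controls the gaps between the
moments of `X`. Even moments increase along the survey channels, so they converge, and those of the
leaf channels converge to the same limits. As `Δ` lives on `[0, 1/2]`, Weierstrass approximation and
compactness turn this into weak convergence to a common law (`exists_tendsto_deltaLaw`), and error
probability and capacity are integrals of continuous functions of `Δ`.
-/

open MeasureTheory ProbabilityTheory Filter Topology

noncomputable section

namespace BOTS

/-! ### The posterior mean of the input -/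

section Bias

variable {Y : Type*} [MeasurableSpace Y]

/-- The posterior mean of the input given the output `y`, for a uniform input in `{±1}`; in terms
of `deltaOf` it is `± (1 - 2 Δ)`. -/
def bias (P : Kernel Bool Y) (y : Y) : ℝ := 2 * posteriorPlus P y - 1

lemma measurable_bias (P : Kernel Bool Y) : Measurable (bias P) := by
  unfold bias posteriorPlus
  fun_prop

lemma deltaOf_eq_bias (P : Kernel Bool Y) (y : Y) : deltaOf P y = (1 - |bias P y|) / 2 := by
  unfold deltaOf bias
  rcases le_total (posteriorPlus P y) (1 / 2) with h | h
  · rw [min_eq_left (by linarith), abs_of_nonpos (by linarith)]; ring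
  · rw [min_eq_right (by linarith), abs_of_nonneg (by linarith)]; ring

lemma outputLaw_eq_of_add (P : Kernel Bool Y) :
    P true + P false = (2 : ENNReal) • outputLaw P := by
  rw [outputLaw, smul_smul, ENNReal.mul_inv_cancel (by norm_num) (by norm_num), one_smul]

lemma outputLaw_ae_iff (P : Kernel Bool Y) :
    ae (outputLaw P) = ae (P true + P false) :=
  Measure.ae_ennreal_smul_measure_eq (by norm_num) _

lemma withDensity_outputLaw (P : Kernel Bool Y) (f : Y → ENNReal) :
    (outputLaw P).withDensity (fun y => 2 * f y) = (P true + P false).withDensity f := by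
  rw [outputLaw_eq_of_add, withDensity_smul_measure, ← withDensity_smul' _ _ (by norm_num)]
  rfl

lemma outputLaw_eq_withDensity {P : Kernel Bool Y} {μ : Measure Y} {f g : Y → ENNReal}
    (hf : Measurable f) (ht : P true = μ.withDensity f) (hu : P false = μ.withDensity g) :
    outputLaw P = μ.withDensity (fun y => 2⁻¹ * (f y + g y)) := by
  rw [outputLaw, ht, hu, ← withDensity_add_left hf, ← withDensity_smul' _ _ (by norm_num)]
  rfl

variable (P : Kernel Bool Y) [IsMarkovKernel P]

lemma rnDeriv_true_le_one :
    ∀ᵐ y ∂(P true + P false), (P true).rnDeriv (P true + P false) y ≤ 1 :=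
  Measure.rnDeriv_le_one_of_le (Measure.le_add_right le_rfl)

lemma bias_mem_Icc : ∀ᵐ y ∂(outputLaw P), bias P y ∈ Set.Icc (-1 : ℝ) 1 := by
  rw [outputLaw_ae_iff]
  filter_upwards [rnDeriv_true_le_one P] with y hy
  have h1 : posteriorPlus P y ≤ 1 := by
    simpa [posteriorPlus] using ENNReal.toReal_mono ENNReal.one_ne_top hy
  have h0 : 0 ≤ posteriorPlus P y := ENNReal.toReal_nonneg
  constructor <;> unfold bias <;> linarith

lemma channel_true_eq_withDensity :
    P true = (outputLaw P).withDensity (fun y => ENNReal.ofReal (1 + bias P y)) := by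
  have h : P true = (P true + P false).withDensity ((P true).rnDeriv (P true + P false)) :=
    (Measure.withDensity_rnDeriv_eq _ _
      (Measure.absolutelyContinuous_of_le (Measure.le_add_right le_rfl))).symm
  conv_lhs => rw [h, ← withDensity_outputLaw]
  refine withDensity_congr_ae ?_
  rw [outputLaw_ae_iff]
  filter_upwards [rnDeriv_true_le_one P] with y hy
  have hne : (P true).rnDeriv (P true + P false) y ≠ ⊤ := ne_top_of_le_ne_top ENNReal.one_ne_top hy
  have : 1 + bias P y = 2 * ((P true).rnDeriv (P true + P false) y).toReal := by
    unfold bias posteriorPlus; ring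
  rw [this, ENNReal.ofReal_mul (by norm_num), ENNReal.ofReal_toReal hne]
  simp

lemma channel_false_eq_withDensity :
    P false = (outputLaw P).withDensity (fun y => ENNReal.ofReal (1 - bias P y)) := by
  have hm := measurable_bias P
  have h : P true + (outputLaw P).withDensity (fun y => ENNReal.ofReal (1 - bias P y))
      = P true + P false := by
    conv_lhs => rw [channel_true_eq_withDensity P]
    rw [← withDensity_add_left (by fun_prop), outputLaw_eq_of_add, ← withDensity_const]
    refine withDensity_congr_ae ?_
    filter_upwards [bias_mem_Icc P] with y hy
    rw [Pi.add_apply, ← ENNReal.ofReal_add (by linarith [hy.1]) (by linarith [hy.2])]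
    norm_num
  exact ((Measure.add_right_inj _ _ _).1 h).symm

variable {P}

/-- Densities of the two output laws with respect to any reference measure determine the bias. -/
lemma density_eq_bias {μ : Measure Y} {f g : Y → ENNReal} (hf : Measurable f) (hg : Measurable g)
    (ht : P true = μ.withDensity f) (hu : P false = μ.withDensity g) :
    ∀ᵐ y ∂μ, f y = 2⁻¹ * (f y + g y) * ENNReal.ofReal (1 + bias P y) ∧
      g y = 2⁻¹ * (f y + g y) * ENNReal.ofReal (1 - bias P y) := by
  have hm := measurable_bias P
  have ho := outputLaw_eq_withDensity hf ht hu
  have h1 := channel_true_eq_withDensity P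
  have h2 := channel_false_eq_withDensity P
  rw [ho, ht, ← withDensity_mul _ (by fun_prop) (by fun_prop)] at h1
  rw [ho, hu, ← withDensity_mul _ (by fun_prop) (by fun_prop)] at h2
  rw [withDensity_eq_iff (by fun_prop) (by fun_prop)] at h1 h2
  · filter_upwards [h1, h2] with y h1 h2
    exact ⟨h1, h2⟩
  · rw [← setLIntegral_univ, ← withDensity_apply _ MeasurableSet.univ, ← hu]
    exact measure_ne_top _ _
  · rw [← setLIntegral_univ, ← withDensity_apply _ MeasurableSet.univ, ← ht]
    exact measure_ne_top _ _

lemma integrable_comp_bias (P : Kernel Bool Y) [IsMarkovKernel P] {φ : ℝ → ℝ} (hφ : Continuous φ) :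
    Integrable (fun y => φ (bias P y)) (outputLaw P) := by
  obtain ⟨C, hC⟩ := (isCompact_Icc (a := (-1 : ℝ)) (b := 1)).exists_bound_of_continuousOn
    hφ.continuousOn
  refine Integrable.of_bound (hφ.measurable.comp (measurable_bias P)).aestronglyMeasurable C ?_
  filter_upwards [bias_mem_Icc P] with y hy using hC _ hy

/-- Expectation of `φ` of the posterior mean of the input, for a uniform input. -/
def biasMean (P : Kernel Bool Y) (φ : ℝ → ℝ) : ℝ := ∫ y, φ (bias P y) ∂(outputLaw P)

lemma biasMean_mono (P : Kernel Bool Y) [IsMarkovKernel P] {φ ψ : ℝ → ℝ} (hφ : Continuous φ)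
    (hψ : Continuous ψ) (h : ∀ x ∈ Set.Icc (-1 : ℝ) 1, φ x ≤ ψ x) :
    biasMean P φ ≤ biasMean P ψ := by
  refine integral_mono_ae (integrable_comp_bias P hφ) (integrable_comp_bias P hψ) ?_
  filter_upwards [bias_mem_Icc P] with y hy using h _ hy

lemma biasMean_const (P : Kernel Bool Y) [IsMarkovKernel P] (c : ℝ) :
    biasMean P (fun _ => c) = c := by
  simp [biasMean]

lemma biasMean_sub (P : Kernel Bool Y) [IsMarkovKernel P] {φ ψ : ℝ → ℝ} (hφ : Continuous φ)
    (hψ : Continuous ψ) :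
    biasMean P (fun x => φ x - ψ x) = biasMean P φ - biasMean P ψ :=
  integral_sub (integrable_comp_bias P hφ) (integrable_comp_bias P hψ)

lemma biasMean_const_mul (P : Kernel Bool Y) (c : ℝ) (φ : ℝ → ℝ) :
    biasMean P (fun x => c * φ x) = c * biasMean P φ :=
  integral_const_mul _ _

lemma setIntegral_bias (P : Kernel Bool Y) [IsMarkovKernel P] {s : Set Y} (hs : MeasurableSet s) :
    ∫ y in s, bias P y ∂(outputLaw P) = ((P true).real s - (P false).real s) / 2 := by
  have hi : IntegrableOn (bias P) s (outputLaw P) :=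
    (integrable_comp_bias P continuous_id).integrableOn
  have h1 : (P true).real s = ∫ y in s, (1 + bias P y) ∂(outputLaw P) := by
    conv_lhs => rw [channel_true_eq_withDensity P]
    rw [measureReal_def, withDensity_apply _ hs, integral_eq_lintegral_of_nonneg_ae]
    · refine ae_restrict_of_ae ?_
      filter_upwards [bias_mem_Icc P] with y hy
      simp only [Pi.zero_apply]; linarith [hy.1]
    · exact ((measurable_bias P).const_add 1).aestronglyMeasurable
  have h2 : (P false).real s = ∫ y in s, (1 - bias P y) ∂(outputLaw P) := by
    conv_lhs => rw [channel_false_eq_withDensity P]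
    rw [measureReal_def, withDensity_apply _ hs, integral_eq_lintegral_of_nonneg_ae]
    · refine ae_restrict_of_ae ?_
      filter_upwards [bias_mem_Icc P] with y hy
      simp only [Pi.zero_apply]; linarith [hy.2]
    · exact ((measurable_bias P).const_sub 1).aestronglyMeasurable
  rw [h1, h2, integral_add (integrable_const _).integrableOn hi,
    integral_sub (integrable_const _).integrableOn hi]
  ring

lemma bhattacharyya_eq_biasMean (P : Kernel Bool Y) [IsMarkovKernel P] :
    bhattacharyya P = biasMean P (fun x => √(1 - x ^ 2)) := by
  unfold bhattacharyya deltaLaw biasMean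
  simp only [ProbabilityMeasure.coe_mk]
  rw [integral_map (measurable_deltaOf P).aemeasurable]
  · refine integral_congr_ae (ae_of_all _ fun y => ?_)
    simp only [deltaOf_eq_bias]
    have : (1 - |bias P y|) / 2 * (1 - (1 - |bias P y|) / 2) = (1 - bias P y ^ 2) / 2 ^ 2 := by
      rw [← sq_abs (bias P y)]; ring
    rw [this, Real.sqrt_div' _ (by positivity), Real.sqrt_sq (by norm_num)]
    ring
  · exact (by fun_prop : Measurable fun x : ℝ => 2 * √(x * (1 - x))).aestronglyMeasurable

/-- The Bhattacharyya coefficient as the Hellinger affinity of the two output laws. -/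
lemma ofReal_bhattacharyya {μ : Measure Y} {f g : Y → ENNReal} (hf : Measurable f)
    (hg : Measurable g) (ht : P true = μ.withDensity f) (hu : P false = μ.withDensity g) :
    ENNReal.ofReal (bhattacharyya P) = ∫⁻ y, (f y * g y) ^ (1 / 2 : ℝ) ∂μ := by
  have hm := measurable_bias P
  rw [bhattacharyya_eq_biasMean, biasMean, ofReal_integral_eq_lintegral_ofReal
    (integrable_comp_bias P (φ := fun x => √(1 - x ^ 2)) (by fun_prop))
    (ae_of_all _ fun y => Real.sqrt_nonneg _)]
  have hae := bias_mem_Icc P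
  rw [outputLaw_eq_withDensity hf ht hu] at hae ⊢
  rw [ae_withDensity_iff (by fun_prop)] at hae
  rw [lintegral_withDensity_eq_lintegral_mul _ (by fun_prop) (by fun_prop)]
  refine lintegral_congr_ae ?_
  filter_upwards [density_eq_bias hf hg ht hu, hae] with y hy hb
  set c := 2⁻¹ * (f y + g y)
  change c * ENNReal.ofReal (√(1 - bias P y ^ 2)) = _
  conv_rhs => rw [hy.1, hy.2]
  by_cases hc : c = 0
  · simp [hc]
  have hb := hb hc
  have h1 : c * ENNReal.ofReal (1 + bias P y) * (c * ENNReal.ofReal (1 - bias P y))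
      = c ^ (2 : ℝ) * ENNReal.ofReal (1 - bias P y ^ 2) := by
    rw [show 1 - bias P y ^ 2 = (1 + bias P y) * (1 - bias P y) by ring,
      ENNReal.ofReal_mul (by linarith [hb.1]), show (2 : ℝ) = ((2 : ℕ) : ℝ) by norm_num,
      ENNReal.rpow_natCast]
    ring
  rw [h1, ENNReal.mul_rpow_of_nonneg _ _ (by norm_num), ← ENNReal.rpow_mul,
    ENNReal.ofReal_rpow_of_nonneg (by nlinarith [hb.1, hb.2]) (by norm_num), ← Real.sqrt_eq_rpow]
  norm_num

/-- Data processing: a deterministic function of the output carries no more information, as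
measured by the mean of a convex function of the posterior mean of the input. -/
lemma biasMean_map_le {Y' : Type*} [MeasurableSpace Y'] (P : Kernel Bool Y) [IsMarkovKernel P]
    {h : Y → Y'} (hh : Measurable h) {φ : ℝ → ℝ} (hφ : Continuous φ)
    (hc : ConvexOn ℝ (Set.Icc (-1) 1) φ) :
    biasMean (P.map h) φ ≤ biasMean P φ := by
  have := Kernel.IsMarkovKernel.map P hh
  have hout : outputLaw (P.map h) = (outputLaw P).map h := by
    simp only [outputLaw, Kernel.map_apply P hh, Measure.map_smul, Measure.map_add _ _ hh]
  have hm : MeasurableSpace.comap h inferInstance ≤ (inferInstance : MeasurableSpace Y) :=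
    hh.comap_le
  have hint := integrable_comp_bias P continuous_id
  have hint' : Integrable (fun y => bias (P.map h) (h y)) (outputLaw P) := by
    have := integrable_comp_bias (P.map h) continuous_id
    rw [hout] at this
    exact this.comp_measurable hh
  have hce : (fun y => bias (P.map h) (h y)) =ᵐ[outputLaw P]
      (outputLaw P)[fun y => id (bias P y) | MeasurableSpace.comap h inferInstance] := by
    refine ae_eq_condExp_of_forall_setIntegral_eq hm hint (fun s _ _ => hint'.integrableOn) ?_ ?_
    · rintro _ ⟨t, ht, rfl⟩ _
      have e1 := setIntegral_bias (P.map h) ht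
      rw [hout, setIntegral_map ht (measurable_bias _).aestronglyMeasurable hh.aemeasurable,
        Kernel.map_apply P hh, Kernel.map_apply P hh, map_measureReal_apply hh ht,
        map_measureReal_apply hh ht] at e1
      rw [e1, ← setIntegral_bias P (hh ht)]
      rfl
    · exact (Measurable.stronglyMeasurable
        ((measurable_bias (P.map h)).comp (comap_measurable h))).aestronglyMeasurable
  have hJ := ConvexOn.map_condExp_le (μ := outputLaw P) hm hc
    (hφ.lowerSemicontinuous.lowerSemicontinuousOn _)
    (bias_mem_Icc P) isClosed_Icc hint (integrable_comp_bias P hφ)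
  calc biasMean (P.map h) φ = ∫ y, φ (bias (P.map h) (h y)) ∂(outputLaw P) := by
        have hφm : Measurable fun y => φ (bias (P.map h) y) :=
          hφ.measurable.comp (measurable_bias _)
        rw [biasMean, hout, integral_map hh.aemeasurable hφm.aestronglyMeasurable]
    _ ≤ ∫ y, ((outputLaw P)[φ ∘ fun y => id (bias P y) |
          MeasurableSpace.comap h inferInstance]) y ∂(outputLaw P) := by
        refine integral_mono_ae ?_ integrable_condExp ?_
        · have := integrable_comp_bias (P.map h) hφ
          rw [hout] at this
          exact this.comp_measurable hh
        · filter_upwards [hce, hJ] with y h1 h2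
          rw [h1]; exact h2
    _ = biasMean P φ := by
        rw [integral_condExp hm]; rfl

end Bias

/-! ### Noisy edges and independent observations -/

section Operations

variable {Y S : Type*} [MeasurableSpace Y] [MeasurableSpace S]

lemma comp_bsc_apply (P : Kernel Bool Y) (δ : unitInterval) (s : Bool) :
    (P ∘ₖ bsc δ) s = ENNReal.ofReal δ • P (!s) + ENNReal.ofReal (1 - δ) • P s := by
  have h1 : bsc δ s = ENNReal.ofReal δ • Measure.dirac (!s)
      + ENNReal.ofReal (1 - δ) • Measure.dirac s := by
    change bernoulliMeasure (!s) s δ = _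
    rw [bernoulliMeasure_def]
    congr 1
    · congr 1
      exact (Real.toNNReal_of_nonneg δ.2.1).symm
    · congr 1
      exact (Real.toNNReal_of_nonneg (unitInterval.symm δ).2.1).symm
  ext t ht
  rw [Kernel.comp_apply' _ _ _ ht, h1, lintegral_add_measure, lintegral_smul_measure,
    lintegral_smul_measure, lintegral_dirac, lintegral_dirac]
  simp

lemma comp_bsc_eq_withDensity (P : Kernel Bool Y) [IsMarkovKernel P] (δ : unitInterval) :
    (P ∘ₖ bsc δ) true = (outputLaw P).withDensity
      (fun y => ENNReal.ofReal (1 + (1 - 2 * (δ : ℝ)) * bias P y)) ∧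
    (P ∘ₖ bsc δ) false = (outputLaw P).withDensity
      (fun y => ENNReal.ofReal (1 - (1 - 2 * (δ : ℝ)) * bias P y)) := by
  have hm := measurable_bias P
  have h0 := δ.2.1
  have h1 := δ.2.2
  constructor
  · rw [comp_bsc_apply, Bool.not_true]
    conv_lhs => rw [channel_true_eq_withDensity P, channel_false_eq_withDensity P]
    rw [← withDensity_smul _ (by fun_prop), ← withDensity_smul _ (by fun_prop),
      ← withDensity_add_left (by fun_prop)]
    refine withDensity_congr_ae ?_
    filter_upwards [bias_mem_Icc P] with y hy
    simp only [Pi.add_apply, Pi.smul_apply, smul_eq_mul]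
    rw [← ENNReal.ofReal_mul h0, ← ENNReal.ofReal_mul (by linarith),
      ← ENNReal.ofReal_add (mul_nonneg h0 (by linarith [hy.2]))
        (mul_nonneg (by linarith) (by linarith [hy.1]))]
    congr 1; ring
  · rw [comp_bsc_apply, Bool.not_false]
    conv_lhs => rw [channel_true_eq_withDensity P, channel_false_eq_withDensity P]
    rw [← withDensity_smul _ (by fun_prop), ← withDensity_smul _ (by fun_prop),
      ← withDensity_add_left (by fun_prop)]
    refine withDensity_congr_ae ?_
    filter_upwards [bias_mem_Icc P] with y hy
    simp only [Pi.add_apply, Pi.smul_apply, smul_eq_mul]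
    rw [← ENNReal.ofReal_mul h0, ← ENNReal.ofReal_mul (by linarith),
      ← ENNReal.ofReal_add (mul_nonneg h0 (by linarith [hy.1]))
        (mul_nonneg (by linarith) (by linarith [hy.2]))]
    congr 1; ring

/-- Flipping the input with probability `δ` keeps the output law and multiplies the posterior mean
by `θ = 1 - 2 δ`. -/
lemma biasMean_comp_bsc (P : Kernel Bool Y) [IsMarkovKernel P] (δ : unitInterval) (φ : ℝ → ℝ) :
    biasMean (P ∘ₖ bsc δ) φ = biasMean P (fun x => φ ((1 - 2 * (δ : ℝ)) * x)) := by
  have hm := measurable_bias P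
  have h0 := δ.2.1
  have h1 := δ.2.2
  obtain ⟨ht, hf⟩ := comp_bsc_eq_withDensity P δ
  have hb : ∀ᵐ y ∂(outputLaw P), |(1 - 2 * (δ : ℝ)) * bias P y| ≤ 1 := by
    filter_upwards [bias_mem_Icc P] with y hy
    rw [abs_mul]
    exact mul_le_one₀ (abs_le.2 ⟨by linarith, by linarith⟩) (abs_nonneg _) (abs_le.2 hy)
  have hsum : ∀ᵐ y ∂(outputLaw P), (2⁻¹ : ENNReal) *
      (ENNReal.ofReal (1 + (1 - 2 * (δ : ℝ)) * bias P y) +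
        ENNReal.ofReal (1 - (1 - 2 * (δ : ℝ)) * bias P y)) = 1 := by
    filter_upwards [hb] with y hy
    rw [abs_le] at hy
    rw [← ENNReal.ofReal_add (by linarith) (by linarith)]
    rw [show ∀ x : ℝ, 1 + x + (1 - x) = 2 by intro x; ring, ENNReal.ofReal_ofNat]
    exact ENNReal.inv_mul_cancel (by norm_num) (by norm_num)
  have hout : outputLaw (P ∘ₖ bsc δ) = outputLaw P := by
    rw [outputLaw_eq_withDensity (by fun_prop) ht hf]
    conv_rhs => rw [← withDensity_one (μ := outputLaw P)]
    exact withDensity_congr_ae hsum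
  rw [biasMean, hout, biasMean]
  refine integral_congr_ae ?_
  have hb' := bias_mem_Icc (P ∘ₖ bsc δ)
  rw [hout] at hb'
  filter_upwards [hb, hsum, hb', density_eq_bias (by fun_prop) (by fun_prop) ht hf]
    with y h1 h2 h3 h4
  rw [h2, one_mul, ENNReal.ofReal_eq_ofReal_iff (by linarith [(abs_le.1 h1).1])
    (by linarith [h3.1])] at h4
  congr 1
  linarith [h4.1]

lemma biasMean_nonneg (P : Kernel Bool Y) {φ : ℝ → ℝ} (h : ∀ x, 0 ≤ φ x) : 0 ≤ biasMean P φ :=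
  integral_nonneg fun _ => h _

lemma bhattacharyya_nonneg (P : Kernel Bool Y) [IsMarkovKernel P] : 0 ≤ bhattacharyya P := by
  rw [bhattacharyya_eq_biasMean]
  exact biasMean_nonneg P fun x => Real.sqrt_nonneg _

lemma bhattacharyya_le_one (P : Kernel Bool Y) [IsMarkovKernel P] : bhattacharyya P ≤ 1 := by
  rw [bhattacharyya_eq_biasMean]
  calc _ ≤ biasMean P (fun _ => 1) := by
        refine biasMean_mono P (by fun_prop) (by fun_prop) fun x _ => ?_
        exact Real.sqrt_le_one.2 (by nlinarith [sq_nonneg x])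
    _ = 1 := biasMean_const P 1

lemma bhattacharyya_prod (P : Kernel Bool Y) [IsMarkovKernel P] (R : Kernel Bool S)
    [IsMarkovKernel R] :
    bhattacharyya (P ×ₖ R) = bhattacharyya P * bhattacharyya R := by
  have hP := measurable_bias P
  have hR := measurable_bias R
  have h := ofReal_bhattacharyya (P := P ×ₖ R) (μ := (outputLaw P).prod (outputLaw R))
    (f := fun z => ENNReal.ofReal (1 + bias P z.1) * ENNReal.ofReal (1 + bias R z.2))
    (g := fun z => ENNReal.ofReal (1 - bias P z.1) * ENNReal.ofReal (1 - bias R z.2))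
    (by fun_prop) (by fun_prop)
    (by
      rw [← prod_withDensity (f := fun y => ENNReal.ofReal (1 + bias P y))
        (g := fun z => ENNReal.ofReal (1 + bias R z)) (by fun_prop) (by fun_prop),
        ← channel_true_eq_withDensity, ← channel_true_eq_withDensity, Kernel.prod_apply])
    (by
      rw [← prod_withDensity (f := fun y => ENNReal.ofReal (1 - bias P y))
        (g := fun z => ENNReal.ofReal (1 - bias R z)) (by fun_prop) (by fun_prop),
        ← channel_false_eq_withDensity, ← channel_false_eq_withDensity, Kernel.prod_apply])
  have h1 := ofReal_bhattacharyya (P := P) (by fun_prop) (by fun_prop)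
    (channel_true_eq_withDensity P) (channel_false_eq_withDensity P)
  have h2 := ofReal_bhattacharyya (P := R) (by fun_prop) (by fun_prop)
    (channel_true_eq_withDensity R) (channel_false_eq_withDensity R)
  rw [← ENNReal.ofReal_eq_ofReal_iff (bhattacharyya_nonneg _)
    (mul_nonneg (bhattacharyya_nonneg _) (bhattacharyya_nonneg _)),
    ENNReal.ofReal_mul (bhattacharyya_nonneg _), h, h1, h2,
    ← lintegral_prod_mul (by fun_prop) (by fun_prop)]
  refine lintegral_congr fun z => ?_
  rw [← ENNReal.mul_rpow_of_nonneg _ _ (by norm_num)]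
  congr 1
  ring

lemma measurable_sigma_iff {X : Type*} [MeasurableSpace X] {F : (Σ n : ℕ, Fin n → S) → X} :
    Measurable F ↔ ∀ n, Measurable fun c : Fin n → S => F ⟨n, c⟩ := by
  constructor
  · intro h n t ht
    exact (MeasurableSpace.measurableSet_iInf.1 (h ht)) n
  · intro h t ht
    exact MeasurableSpace.measurableSet_iInf.2 fun n => h n ht

lemma measurable_sigma_mk (n : ℕ) :
    Measurable (fun c : Fin n → S => (⟨n, c⟩ : Σ m : ℕ, Fin m → S)) :=
  measurable_sigma_iff.1 measurable_id n

lemma lintegral_forest (N : Measure ℕ) (κ : Kernel Bool S) (s : Bool)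
    {F : (Σ n : ℕ, Fin n → S) → ENNReal} (hF : Measurable F) :
    ∫⁻ x, F x ∂(forest N κ s) = ∫⁻ n, ∫⁻ c, F ⟨n, c⟩ ∂(Measure.pi fun _ : Fin n => κ s) ∂N := by
  change ∫⁻ x, F x ∂(N.bind _) = _
  rw [Measure.lintegral_bind (by fun_prop) hF.aemeasurable]
  refine lintegral_congr fun n => ?_
  rw [lintegral_map hF (measurable_sigma_mk n)]

lemma lintegral_pi_prod {ι : Type*} [Fintype ι] {μ : Measure S} [IsProbabilityMeasure μ]
    {f : ι → S → ENNReal} (hf : ∀ i, Measurable (f i)) :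
    ∫⁻ c, ∏ i, f i (c i) ∂(Measure.pi fun _ : ι => μ) = ∏ i, ∫⁻ x, f i x ∂μ := by
  rw [lintegral_prod_eq_prod_lintegral_of_indepFun Finset.univ (fun i (c : ι → S) => f i (c i))
    (iIndepFun_pi fun i => (hf i).aemeasurable)
    (fun i => (hf i).comp (measurable_pi_apply i))]
  refine Finset.prod_congr rfl fun i _ => ?_
  exact (measurePreserving_eval (fun _ : ι => μ) i).lintegral_comp (hf i)

lemma pi_withDensity {ι : Type*} [Fintype ι] {μ : Measure S} [IsProbabilityMeasure μ]
    {f : S → ENNReal} (hf : Measurable f) [SigmaFinite (μ.withDensity f)] :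
    Measure.pi (fun _ : ι => μ.withDensity f)
      = (Measure.pi fun _ : ι => μ).withDensity (fun c => ∏ i, f (c i)) := by
  refine Measure.pi_eq fun s hs => ?_
  rw [withDensity_apply _ (MeasurableSet.univ_pi hs), ← lintegral_indicator
    (MeasurableSet.univ_pi hs)]
  have : ∀ c : ι → S, (Set.univ.pi s).indicator (fun c => ∏ i, f (c i)) c
      = ∏ i, (s i).indicator f (c i) := by
    intro c
    by_cases hc : c ∈ Set.univ.pi s
    · rw [Set.indicator_of_mem hc]
      exact Finset.prod_congr rfl fun i _ => (Set.indicator_of_mem (hc i trivial) f).symm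
    · rw [Set.indicator_of_notMem hc]
      simp only [Set.mem_univ_pi, not_forall] at hc
      obtain ⟨i, hi⟩ := hc
      exact (Finset.prod_eq_zero (Finset.mem_univ i) (Set.indicator_of_notMem hi f)).symm
  simp_rw [this]
  rw [lintegral_pi_prod fun i => hf.indicator (hs i)]
  refine Finset.prod_congr rfl fun i _ => ?_
  rw [withDensity_apply _ (hs i), lintegral_indicator (hs i)]

lemma forest_eq_withDensity (N : Measure ℕ) {κ : Kernel Bool S} [IsMarkovKernel κ] {s : Bool}
    {μ : Measure S} [IsProbabilityMeasure μ] {f : S → ENNReal} (hf : Measurable f)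
    (h : κ s = μ.withDensity f) :
    forest N κ s = (forest N (Kernel.const Bool μ) s).withDensity
      (fun x => ∏ i, f (x.2 i)) := by
  have hF : Measurable fun x : (Σ n : ℕ, Fin n → S) => ∏ i, f (x.2 i) :=
    measurable_sigma_iff.2 fun n => by
      show Measurable fun c : Fin n → S => ∏ i, f (c i)
      fun_prop
  ext t ht
  have : SigmaFinite (μ.withDensity f) := by rw [← h]; infer_instance
  rw [withDensity_apply _ ht, ← lintegral_indicator ht, lintegral_forest N _ s (hF.indicator ht),
    ← lintegral_indicator_one ht, lintegral_forest N _ s (measurable_one.indicator ht)]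
  refine lintegral_congr fun n => ?_
  have htn := measurable_sigma_mk n ht
  have e1 : ∀ (g : (Σ n : ℕ, Fin n → S) → ENNReal) (c : Fin n → S),
      t.indicator g ⟨n, c⟩ = (Sigma.mk n ⁻¹' t).indicator (fun c => g ⟨n, c⟩) c := fun g c => rfl
  simp_rw [e1]
  rw [lintegral_indicator htn, lintegral_indicator htn, h, pi_withDensity hf, Kernel.const_apply,
    ← withDensity_apply _ htn]
  simp [withDensity_apply _ htn]

/-- The Bhattacharyya coefficient is multiplicative over independent observations; given the number
of children, which is observed, a forest consists of that many independent observations. -/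
lemma bhattacharyya_forest (N : Measure ℕ) [IsProbabilityMeasure N] (κ : Kernel Bool S)
    [IsMarkovKernel κ] :
    bhattacharyya (forest N κ) = ∫ n, bhattacharyya κ ^ n ∂N := by
  have hm := measurable_bias κ
  have hF : ∀ f : S → ENNReal, Measurable f →
      Measurable fun x : (Σ n : ℕ, Fin n → S) => ∏ i, f (x.2 i) := fun f hf =>
    measurable_sigma_iff.2 fun n => by
      show Measurable fun c : Fin n → S => ∏ i, f (c i)
      fun_prop
  have h := ofReal_bhattacharyya (P := forest N κ) (hF _ (by fun_prop)) (hF _ (by fun_prop))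
    (forest_eq_withDensity N (by fun_prop) (channel_true_eq_withDensity κ))
    (forest_eq_withDensity N (by fun_prop) (channel_false_eq_withDensity κ))
  have h1 := ofReal_bhattacharyya (P := κ) (by fun_prop) (by fun_prop)
    (channel_true_eq_withDensity κ) (channel_false_eq_withDensity κ)
  have hpm : Measurable fun x : (Σ n : ℕ, Fin n → S) =>
      ((∏ i, ENNReal.ofReal (1 + bias κ (x.2 i))) *
        ∏ i, ENNReal.ofReal (1 - bias κ (x.2 i))) ^ (1 / 2 : ℝ) :=
    ((hF (fun y => ENNReal.ofReal (1 + bias κ y)) (by fun_prop)).mul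
      (hF (fun y => ENNReal.ofReal (1 - bias κ y)) (by fun_prop))).pow_const _
  rw [lintegral_forest N _ _ hpm] at h
  have h0 := bhattacharyya_nonneg κ
  rw [integral_eq_lintegral_of_nonneg_ae (ae_of_all _ fun n => pow_nonneg h0 n)
    (Measurable.of_discrete.aestronglyMeasurable),
    ← ENNReal.toReal_ofReal (bhattacharyya_nonneg (forest N κ)), h]
  congr 1
  refine lintegral_congr fun n => ?_
  rw [ENNReal.ofReal_pow h0, h1]
  simp_rw [← Finset.prod_mul_distrib, ← ENNReal.prod_rpow_of_nonneg (by norm_num : (0:ℝ) ≤ 1 / 2)]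
  rw [Kernel.const_apply, lintegral_pi_prod (f := fun _ y => (ENNReal.ofReal (1 + bias κ y) *
    ENNReal.ofReal (1 - bias κ y)) ^ (1 / 2 : ℝ)) (fun i => by fun_prop)]
  simp

end Operations

/-! ### Second moments and linear estimators -/

section SecondMoment

variable {Y S : Type*} [MeasurableSpace Y] [MeasurableSpace S]

lemma integral_channel_true (P : Kernel Bool Y) [IsMarkovKernel P] (g : Y → ℝ) :
    ∫ y, g y ∂(P true) = ∫ y, (1 + bias P y) * g y ∂(outputLaw P) := by
  have hm := measurable_bias P
  conv_lhs => rw [channel_true_eq_withDensity P]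
  rw [integral_withDensity_eq_integral_toReal_smul (by fun_prop)
    (ae_of_all _ fun y => ENNReal.ofReal_lt_top)]
  refine integral_congr_ae ?_
  filter_upwards [bias_mem_Icc P] with y hy
  rw [ENNReal.toReal_ofReal (by linarith [hy.1]), smul_eq_mul]

lemma integral_channel_false (P : Kernel Bool Y) [IsMarkovKernel P] (g : Y → ℝ) :
    ∫ y, g y ∂(P false) = ∫ y, (1 - bias P y) * g y ∂(outputLaw P) := by
  have hm := measurable_bias P
  conv_lhs => rw [channel_false_eq_withDensity P]
  rw [integral_withDensity_eq_integral_toReal_smul (by fun_prop)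
    (ae_of_all _ fun y => ENNReal.ofReal_lt_top)]
  refine integral_congr_ae ?_
  filter_upwards [bias_mem_Icc P] with y hy
  rw [ENNReal.toReal_ofReal (by linarith [hy.2]), smul_eq_mul]

lemma channel_absolutelyContinuous (P : Kernel Bool Y) [IsMarkovKernel P] (s : Bool) :
    P s ≪ outputLaw P := by
  cases s
  · rw [channel_false_eq_withDensity P]; exact withDensity_absolutelyContinuous _ _
  · rw [channel_true_eq_withDensity P]; exact withDensity_absolutelyContinuous _ _

/-- Any estimator `g` of the input bounds the second moment of the posterior mean from below. -/
lemma sq_integral_sub_le (P : Kernel Bool Y) [IsMarkovKernel P] {g : Y → ℝ}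
    (hg : ∀ s, MemLp g 2 (P s)) :
    (∫ y, g y ∂(P true) - ∫ y, g y ∂(P false)) ^ 2 ≤
      2 * biasMean P (fun x => x ^ 2) * (∫ y, g y ^ 2 ∂(P true) + ∫ y, g y ^ 2 ∂(P false)) := by
  have hm := measurable_bias P
  have hg' : MemLp g 2 (outputLaw P) := by
    rw [outputLaw]
    refine MemLp.smul_measure ?_ (by norm_num)
    have h1 := hg true
    have h2 := hg false
    refine ⟨h1.1.add_measure h2.1, ?_⟩
    have i1 := h1.integrable_sq
    have i2 := h2.integrable_sq
    exact ((memLp_two_iff_integrable_sq (h1.1.add_measure h2.1)).2 (i1.add_measure i2)).2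
  have hb : MemLp (bias P) 2 (outputLaw P) :=
    (memLp_two_iff_integrable_sq hm.aestronglyMeasurable).2
      (integrable_comp_bias P (φ := fun x => x ^ 2) (by fun_prop))
  have hgi : Integrable g (outputLaw P) := hg'.integrable (by norm_num)
  have hgb : Integrable (fun y => bias P y * g y) (outputLaw P) := hb.integrable_mul hg'
  have e1 : ∫ y, g y ∂(P true) - ∫ y, g y ∂(P false)
      = 2 * ∫ y, bias P y * g y ∂(outputLaw P) := by
    rw [integral_channel_true, integral_channel_false]
    simp_rw [add_mul, sub_mul, one_mul]
    rw [integral_add hgi hgb, integral_sub hgi hgb]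
    ring
  have e2 : ∫ y, g y ^ 2 ∂(P true) + ∫ y, g y ^ 2 ∂(P false)
      = 2 * ∫ y, g y ^ 2 ∂(outputLaw P) := by
    rw [← integral_add_measure (hg true).integrable_sq (hg false).integrable_sq,
      outputLaw_eq_of_add, integral_smul_measure]
    simp
  have hquad : ∀ t : ℝ, 0 ≤ biasMean P (fun x => x ^ 2) * (t * t)
      + (-2 * ∫ y, bias P y * g y ∂(outputLaw P)) * t + ∫ y, g y ^ 2 ∂(outputLaw P) := by
    intro t
    have h0 : 0 ≤ ∫ y, (t * bias P y - g y) ^ 2 ∂(outputLaw P) :=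
      integral_nonneg fun _ => sq_nonneg _
    have : ∀ y, (t * bias P y - g y) ^ 2
        = (t * t) * bias P y ^ 2 - (2 * t) * (bias P y * g y) + g y ^ 2 := fun y => by ring
    simp_rw [this] at h0
    rw [integral_add, integral_sub, integral_const_mul, integral_const_mul] at h0
    · have hbm : biasMean P (fun x => x ^ 2) = ∫ y, bias P y ^ 2 ∂(outputLaw P) := rfl
      rw [hbm]
      linarith
    · exact hb.integrable_sq.const_mul _
    · exact hgb.const_mul _
    · exact (hb.integrable_sq.const_mul _).sub (hgb.const_mul _)
    · exact hg'.integrable_sq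
  have := discrim_le_zero hquad
  rw [discrim] at this
  rw [e1, e2]
  nlinarith

lemma integral_bias (P : Kernel Bool Y) [IsMarkovKernel P] : ∫ y, bias P y ∂(outputLaw P) = 0 := by
  rw [← setIntegral_univ, setIntegral_bias P MeasurableSet.univ]
  simp

lemma integral_forest (N : Measure ℕ) [IsProbabilityMeasure N] (κ : Kernel Bool S)
    [IsMarkovKernel κ] (s : Bool) {F : (Σ n : ℕ, Fin n → S) → ℝ}
    (hF : Measurable F) (hi : Integrable F (forest N κ s)) :
    ∫ x, F x ∂(forest N κ s) = ∫ n, ∫ c, F ⟨n, c⟩ ∂(Measure.pi fun _ : Fin n => κ s) ∂N := by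
  let η : Kernel ℕ (Σ n : ℕ, Fin n → S) := Kernel.ofFunOfCountable fun n =>
    (Measure.pi fun _ : Fin n => κ s).map (Sigma.mk n)
  have h : forest N κ s = (η ∘ₖ Kernel.const Unit N) () := rfl
  rw [h] at hi ⊢
  rw [Kernel.integral_comp hi, Kernel.const_apply]
  refine integral_congr_ae (ae_of_all _ fun n => ?_)
  change ∫ y, F y ∂((Measure.pi fun _ : Fin n => κ s).map (Sigma.mk n)) = _
  rw [integral_map (measurable_sigma_mk n).aemeasurable hF.aestronglyMeasurable]

lemma integral_pi_sum {μ : Measure S} [IsProbabilityMeasure μ] {g : S → ℝ} (hg : MemLp g 2 μ)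
    (n : ℕ) :
    ∫ c, ∑ i, g (c i) ∂(Measure.pi fun _ : Fin n => μ) = n * ∫ x, g x ∂μ := by
  have hi : Integrable g μ := hg.integrable (by norm_num)
  rw [integral_finsetSum _ fun i _ => integrable_comp_eval hi]
  simp_rw [integral_comp_eval (μ := fun _ : Fin n => μ) hi.aestronglyMeasurable]
  simp

lemma integral_pi_sum_sq {μ : Measure S} [IsProbabilityMeasure μ] {g : S → ℝ} (hg : MemLp g 2 μ)
    (n : ℕ) :
    ∫ c, (∑ i, g (c i)) ^ 2 ∂(Measure.pi fun _ : Fin n => μ)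
      = n * (∫ x, g x ^ 2 ∂μ - (∫ x, g x ∂μ) ^ 2) + n ^ 2 * (∫ x, g x ∂μ) ^ 2 := by
  have hmem : ∀ i : Fin n, MemLp (fun c : Fin n → S => g (c i)) 2
      (Measure.pi fun _ : Fin n => μ) := fun i =>
    hg.comp_measurePreserving (measurePreserving_eval _ i)
  have h1 := variance_sum_pi (μ := fun _ : Fin n => μ) (X := fun _ => g) (fun _ => hg)
  have h2 := variance_eq_sub (memLp_finsetSum' Finset.univ fun i _ => hmem i)
  rw [h1] at h2
  simp only [Pi.pow_apply, Finset.sum_apply] at h2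
  rw [integral_pi_sum hg, variance_eq_sub hg] at h2
  simp only [Pi.pow_apply, Finset.sum_const, Finset.card_univ, Fintype.card_fin,
    nsmul_eq_mul] at h2
  linarith

/-- Lower bound on the second moment of the posterior mean given a forest, obtained from the linear
estimator that adds up the posterior means given the single subtrees. -/
lemma sq_mul_sq_le_biasMean_forest (N : Measure ℕ) [IsProbabilityMeasure N] (κ : Kernel Bool S)
    [IsMarkovKernel κ] (hN : Integrable (fun n : ℕ => (n : ℝ) ^ 2) N) {v : ℝ}
    (hv : biasMean κ (fun x => x ^ 2) = v) :
    (∫ n, (n : ℝ) ∂N) ^ 2 * v ^ 2 ≤ biasMean (forest N κ) (fun x => x ^ 2) *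
      ((∫ n, (n : ℝ) ∂N) * (v - v ^ 2) + (∫ n, (n : ℝ) ^ 2 ∂N) * v ^ 2) := by
  have hm := measurable_bias κ
  have hN1 : Integrable (fun n : ℕ => (n : ℝ)) N := by
    refine hN.mono' Measurable.of_discrete.aestronglyMeasurable (ae_of_all _ fun n => ?_)
    rw [Real.norm_natCast]
    exact_mod_cast Nat.le_self_pow (by norm_num) n
  -- The bias lies in `[-1, 1]` only almost everywhere; truncation makes the bound hold everywhere.
  set g : S → ℝ := fun x => max (-1) (min 1 (bias κ x)) with hg
  have hgm : Measurable g := by fun_prop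
  have hg1 : ∀ x, |g x| ≤ 1 := fun x =>
    abs_le.2 ⟨le_max_left _ _, max_le (by norm_num) (min_le_left _ _)⟩
  have hgb : g =ᵐ[outputLaw κ] bias κ := by
    filter_upwards [bias_mem_Icc κ] with x hx
    simp only [hg]
    rw [min_eq_right hx.2, max_eq_right hx.1]
  have hg2 : ∀ s, MemLp g 2 (κ s) := fun s =>
    MemLp.of_bound hgm.aestronglyMeasurable 1 (ae_of_all _ hg1)
  have hbi : Integrable (fun y => bias κ y) (outputLaw κ) :=
    integrable_comp_bias κ continuous_id
  have hb2i := integrable_comp_bias κ (φ := fun x => x ^ 2) (by fun_prop)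
  have hmt : ∫ x, g x ∂(κ true) = v := by
    rw [integral_congr_ae ((channel_absolutelyContinuous κ true).ae_eq hgb),
      integral_channel_true, ← hv, biasMean]
    simp_rw [add_mul, one_mul, ← sq]
    rw [integral_add hbi hb2i, integral_bias, zero_add]
  have hmf : ∫ x, g x ∂(κ false) = -v := by
    rw [integral_congr_ae ((channel_absolutelyContinuous κ false).ae_eq hgb),
      integral_channel_false, ← hv, biasMean]
    simp_rw [sub_mul, one_mul, ← sq]
    rw [integral_sub hbi hb2i, integral_bias, zero_sub]
  have hq : ∫ x, g x ^ 2 ∂(κ true) + ∫ x, g x ^ 2 ∂(κ false) = 2 * v := by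
    rw [← integral_add_measure (hg2 true).integrable_sq (hg2 false).integrable_sq,
      outputLaw_eq_of_add, integral_smul_measure, ← hv, biasMean]
    rw [integral_congr_ae (g := fun y => bias κ y ^ 2)]
    · simp
    · filter_upwards [hgb] with x hx
      rw [hx]
  set T : (Σ n : ℕ, Fin n → S) → ℝ := fun x => ∑ i, g (x.2 i) with hT
  have hTm : Measurable T := measurable_sigma_iff.2 fun n => by
    show Measurable fun c : Fin n → S => ∑ i, g (c i)
    fun_prop
  have hfst : Measurable fun x : (Σ n : ℕ, Fin n → S) => (x.1 : ℝ) ^ 2 :=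
    measurable_sigma_iff.2 fun n => measurable_const (a := (n : ℝ) ^ 2)
  have hT1 : ∀ x, |T x| ≤ x.1 := fun x => by
    calc |T x| ≤ ∑ i, |g (x.2 i)| := Finset.abs_sum_le_sum_abs _ _
      _ ≤ ∑ i : Fin x.1, (1 : ℝ) := Finset.sum_le_sum fun i _ => hg1 _
      _ = x.1 := by simp
  have hT2i : ∀ s, Integrable (fun x => T x ^ 2) (forest N κ s) := fun s => by
    have : Integrable (fun x : (Σ n : ℕ, Fin n → S) => (x.1 : ℝ) ^ 2) (forest N κ s) := by
      refine ⟨hfst.aestronglyMeasurable, ?_⟩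
      rw [hasFiniteIntegral_iff_enorm, lintegral_forest N κ s hfst.enorm]
      have h2 := hN.2
      rw [hasFiniteIntegral_iff_enorm] at h2
      simpa using h2
    refine this.mono' (hTm.pow_const 2).aestronglyMeasurable (ae_of_all _ fun x => ?_)
    rw [Real.norm_of_nonneg (sq_nonneg _), ← sq_abs]
    exact pow_le_pow_left₀ (abs_nonneg _) (hT1 x) 2
  have hTL : ∀ s, MemLp T 2 (forest N κ s) := fun s =>
    (memLp_two_iff_integrable_sq hTm.aestronglyMeasurable).2 (hT2i s)
  have hI1 : ∀ s, ∫ x, T x ∂(forest N κ s) = (∫ n, (n : ℝ) ∂N) * ∫ x, g x ∂(κ s) := fun s => by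
    rw [integral_forest N κ s hTm ((hTL s).integrable (by norm_num))]
    simp only [hT]
    simp_rw [integral_pi_sum (hg2 s)]
    rw [integral_mul_const]
  have hI2 : ∀ s, ∫ x, T x ^ 2 ∂(forest N κ s)
      = (∫ n, (n : ℝ) ∂N) * (∫ x, g x ^ 2 ∂(κ s) - (∫ x, g x ∂(κ s)) ^ 2)
        + (∫ n, (n : ℝ) ^ 2 ∂N) * (∫ x, g x ∂(κ s)) ^ 2 := fun s => by
    rw [integral_forest N κ s (hTm.pow_const 2) (hT2i s)]
    simp only [hT]
    simp_rw [integral_pi_sum_sq (hg2 s)]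
    rw [integral_add (hN1.mul_const _) (hN.mul_const _), integral_mul_const, integral_mul_const]
  have key := sq_integral_sub_le (forest N κ) hTL
  rw [hI1, hI1, hI2, hI2, hmt, hmf] at key
  have hq' : ∫ x, g x ^ 2 ∂(κ false) = 2 * v - ∫ x, g x ^ 2 ∂(κ true) := by linarith
  rw [hq'] at key
  nlinarith

end SecondMoment

/-! ### The tree recursion and degradation of channels -/

section Recursion

universe u

variable {Y : Type u} {S S' : Type*} [MeasurableSpace Y] [MeasurableSpace S] [MeasurableSpace S']

lemma forest_apply (N : Measure ℕ) (κ : Kernel Bool S) (s : Bool)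
    {t : Set (Σ n : ℕ, Fin n → S)} (ht : MeasurableSet t) :
    forest N κ s t = ∫⁻ n, (Measure.pi fun _ : Fin n => κ s) ((fun c => ⟨n, c⟩) ⁻¹' t) ∂N := by
  change (N.bind _) t = _
  rw [Measure.bind_apply ht (by fun_prop)]
  exact lintegral_congr fun n => Measure.map_apply (measurable_sigma_mk n) ht

/-- Apply `h` to each entry of a finite family. -/
def mapFamily (h : S → S') (x : Σ n : ℕ, Fin n → S) : Σ n : ℕ, Fin n → S' :=
  ⟨x.1, fun i => h (x.2 i)⟩

lemma measurable_mapFamily {h : S → S'} (hh : Measurable h) : Measurable (mapFamily h) :=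
  measurable_sigma_iff.2 fun n => by
    show Measurable ((fun c : Fin n → S' => (⟨n, c⟩ : Σ n : ℕ, Fin n → S')) ∘
      fun (c : Fin n → S) i => h (c i))
    exact (measurable_sigma_mk n).comp (by fun_prop)

lemma forest_map (N : Measure ℕ) (κ : Kernel Bool S) [IsMarkovKernel κ] {h : S → S'}
    (hh : Measurable h) : (forest N κ).map (mapFamily h) = forest N (κ.map h) := by
  ext s t ht
  rw [Kernel.map_apply' _ (measurable_mapFamily hh) _ ht,
    forest_apply _ _ _ (measurable_mapFamily hh ht), forest_apply _ _ _ ht]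
  refine lintegral_congr fun n => ?_
  rw [Kernel.map_apply _ hh, ← Measure.pi_map_pi (fun _ => hh.aemeasurable),
    Measure.map_apply (by fun_prop) (measurable_sigma_mk n ht)]
  rfl

/-- One step of the tree recursion: the channel that observes the survey of the root together with
the outputs of the channel `R` at the children of the root. -/
def treeStep (N : Measure ℕ) (δ : unitInterval) (W : Kernel Bool Y) (R : Kernel Bool S) :
    Kernel Bool (Y × Σ n : ℕ, Fin n → S) :=
  W ×ₖ forest N (R ∘ₖ bsc δ)

lemma surveyChannel_zero (N : Measure ℕ) (δ : unitInterval) (W : Kernel Bool Y)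
    [IsMarkovKernel W] : surveyChannel N δ W 0 = W := by
  change (Kernel.id ×ₖ W).map Prod.snd = W
  rw [← Kernel.snd_eq, Kernel.snd_prod]

variable (N : Measure ℕ) [IsProbabilityMeasure N] (δ : unitInterval) (W : Kernel Bool Y)
  [IsMarkovKernel W]

instance (R : Kernel Bool S) [IsMarkovKernel R] : IsMarkovKernel (treeStep N δ W R) :=
  inferInstanceAs (IsMarkovKernel (W ×ₖ forest N (R ∘ₖ bsc δ)))

lemma treeStep_map (R : Kernel Bool S) [IsMarkovKernel R] {h : S → S'} (hh : Measurable h) :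
    (treeStep N δ W R).map (Prod.map id (mapFamily h)) = treeStep N δ W (R.map h) := by
  have := Kernel.IsMarkovKernel.map R hh
  rw [treeStep, ← Kernel.map_prod_map _ _ measurable_id (measurable_mapFamily hh), Kernel.map_id,
    forest_map N _ hh, Kernel.map_comp, treeStep]

lemma broadcast_map_succ {B : Type u} [MeasurableSpace B] {g : Bool × Y → B} (hg : Measurable g)
    (k : ℕ) :
    (broadcast N δ W (k + 1)).map (LabTree.map Prod.snd g (k + 1))
      = treeStep N δ W ((broadcast N δ W k).map (LabTree.map Prod.snd g k)) := by
  have hm := LabTree.measurable_map (measurable_snd : Measurable (Prod.snd : Bool × Y → Y)) hg k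
  have h : LabTree.map (Prod.snd : Bool × Y → Y) g (k + 1)
      = Prod.map Prod.snd (mapFamily (LabTree.map Prod.snd g k)) := rfl
  rw [h]
  refine (Kernel.map_prod_map (Kernel.id ×ₖ W) (forest N (broadcast N δ W k ∘ₖ bsc δ))
    measurable_snd (measurable_mapFamily hm)).symm.trans ?_
  rw [forest_map N _ hm, Kernel.map_comp, ← Kernel.snd_eq, Kernel.snd_prod]
  rfl

lemma surveyChannel_succ (k : ℕ) :
    surveyChannel N δ W (k + 1) = treeStep N δ W (surveyChannel N δ W k) :=
  broadcast_map_succ N δ W measurable_snd k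

lemma leafChannel_succ (k : ℕ) :
    leafChannel N δ W (k + 1) = treeStep N δ W (leafChannel N δ W k) :=
  broadcast_map_succ N δ W measurable_swap k

/-- The survey channel is a function of the leaf channel: forget the bits at the last level. -/
lemma exists_leafChannel_map_eq (k : ℕ) : ∃ h : LabTree Y (Y × Bool) k → LabTree Y Y k,
    Measurable h ∧ surveyChannel N δ W k = (leafChannel N δ W k).map h := by
  induction k with
  | zero =>
    refine ⟨Prod.fst, measurable_fst, ?_⟩
    change (Kernel.id ×ₖ W).map Prod.snd = ((Kernel.id ×ₖ W).map Prod.swap).map Prod.fst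
    rw [← Kernel.map_comp_right _ measurable_swap measurable_fst]
    rfl
  | succ k ih =>
    obtain ⟨h, hh, he⟩ := ih
    refine ⟨Prod.map id (mapFamily h), measurable_id.prodMap (measurable_mapFamily hh), ?_⟩
    rw [surveyChannel_succ, leafChannel_succ, he]
    exact (treeStep_map N δ W _ hh).symm

/-- The survey channel at level `k` is a function of the one at level `k + 1`: forget the last
level. -/
lemma exists_surveyChannel_map_eq (k : ℕ) : ∃ h : LabTree Y Y (k + 1) → LabTree Y Y k,
    Measurable h ∧ surveyChannel N δ W k = (surveyChannel N δ W (k + 1)).map h := by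
  induction k with
  | zero =>
    refine ⟨Prod.fst, measurable_fst, ?_⟩
    rw [surveyChannel_succ, surveyChannel_zero]
    change W = (W ×ₖ forest N (W ∘ₖ bsc δ)).map Prod.fst
    rw [← Kernel.fst_eq, Kernel.fst_prod]
  | succ k ih =>
    obtain ⟨h, hh, he⟩ := ih
    refine ⟨Prod.map id (mapFamily h), measurable_id.prodMap (measurable_mapFamily hh), ?_⟩
    rw [surveyChannel_succ N δ W (k + 1)]
    conv_lhs => rw [surveyChannel_succ, he]
    exact (treeStep_map N δ W _ hh).symm

lemma bhattacharyya_treeStep (R : Kernel Bool S) [IsMarkovKernel R] :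
    bhattacharyya (treeStep N δ W R)
      = bhattacharyya W * ∫ n, bhattacharyya (R ∘ₖ bsc δ) ^ n ∂N := by
  unfold treeStep
  rw [bhattacharyya_prod, bhattacharyya_forest]

lemma convexOn_sq_Icc : ConvexOn ℝ (Set.Icc (-1 : ℝ) 1) (fun x => x ^ 2) :=
  (even_two.convexOn_pow (𝕜 := ℝ)).subset (Set.subset_univ _) (convex_Icc _ _)

lemma biasMean_forest_le_treeStep (R : Kernel Bool S) [IsMarkovKernel R] :
    biasMean (forest N (R ∘ₖ bsc δ)) (fun x => x ^ 2)
      ≤ biasMean (treeStep N δ W R) (fun x => x ^ 2) := by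
  have h : forest N (R ∘ₖ bsc δ) = (treeStep N δ W R).map Prod.snd := by
    unfold treeStep
    rw [← Kernel.snd_eq, Kernel.snd_prod]
  rw [h]
  exact biasMean_map_le _ measurable_snd (by fun_prop) convexOn_sq_Icc

end Recursion

/-! ### Convexity of test functions -/

section Convexity

lemma hasDerivAt_sqrt_one_sub {c x : ℝ} (h : 0 < 1 - c * x ^ 2) :
    HasDerivAt (fun x => √(1 - c * x ^ 2)) (-(c * x) / √(1 - c * x ^ 2)) x := by
  have h1 : HasDerivAt (fun x : ℝ => 1 - c * x ^ 2) (-(c * (2 * x))) x := by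
    have := ((hasDerivAt_pow 2 x).const_mul c).const_sub 1
    simpa using this
  convert! h1.sqrt h.ne' using 1
  field_simp

lemma hasDerivAt_deriv_sqrt_one_sub {c x : ℝ} (h : 0 < 1 - c * x ^ 2) :
    HasDerivAt (fun x => -(c * x) / √(1 - c * x ^ 2)) (-c / √(1 - c * x ^ 2) ^ 3) x := by
  have hs : 0 < √(1 - c * x ^ 2) := Real.sqrt_pos.2 h
  have hs2 : √(1 - c * x ^ 2) ^ 2 = 1 - c * x ^ 2 := Real.sq_sqrt h.le
  have h1 : HasDerivAt (fun x : ℝ => -(c * x)) (-c) x := by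
    simpa using ((hasDerivAt_id x).const_mul c).fun_neg
  convert! h1.div (hasDerivAt_sqrt_one_sub h) hs.ne' using 1
  field_simp
  linear_combination c * hs2

lemma one_sub_mul_sq_pos {c x : ℝ} (hc : c ≤ 1) (hx : x ∈ Set.Ioo (-1 : ℝ) 1) :
    0 < 1 - c * x ^ 2 := by
  have : x ^ 2 < 1 := by nlinarith [hx.1, hx.2]
  nlinarith [sq_nonneg x]

/-- The convexity that drives the contraction of the Bhattacharyya coefficient: the second
derivative is `c ((1 - x²)^(-3/2) - (1 - c x²)^(-3/2))`. -/
lemma convexOn_sqrt_sub_mul_sqrt {c : ℝ} (hc0 : 0 ≤ c) (hc1 : c ≤ 1) :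
    ConvexOn ℝ (Set.Icc (-1 : ℝ) 1) (fun x => √(1 - c * x ^ 2) - c * √(1 - 1 * x ^ 2)) := by
  refine convexOn_of_hasDerivWithinAt2_nonneg (convex_Icc _ _) (by fun_prop)
    (f' := fun x => -(c * x) / √(1 - c * x ^ 2) - c * (-(1 * x) / √(1 - 1 * x ^ 2)))
    (f'' := fun x => -c / √(1 - c * x ^ 2) ^ 3 - c * (-1 / √(1 - 1 * x ^ 2) ^ 3)) ?_ ?_ ?_
  · intro x hx
    rw [interior_Icc] at hx
    exact ((hasDerivAt_sqrt_one_sub (one_sub_mul_sq_pos hc1 hx)).sub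
      ((hasDerivAt_sqrt_one_sub (one_sub_mul_sq_pos le_rfl hx)).const_mul c)).hasDerivWithinAt
  · intro x hx
    rw [interior_Icc] at hx
    exact ((hasDerivAt_deriv_sqrt_one_sub (one_sub_mul_sq_pos hc1 hx)).sub
      ((hasDerivAt_deriv_sqrt_one_sub (one_sub_mul_sq_pos le_rfl hx)).const_mul
        c)).hasDerivWithinAt
  · intro x hx
    rw [interior_Icc] at hx
    have h1 : 0 < √(1 - 1 * x ^ 2) := Real.sqrt_pos.2 (one_sub_mul_sq_pos le_rfl hx)
    have h2 : √(1 - 1 * x ^ 2) ≤ √(1 - c * x ^ 2) :=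
      Real.sqrt_le_sqrt (by nlinarith [sq_nonneg x])
    have h3 : 1 / √(1 - c * x ^ 2) ^ 3 ≤ 1 / √(1 - 1 * x ^ 2) ^ 3 :=
      one_div_le_one_div_of_le (by positivity) (pow_le_pow_left₀ h1.le h2 3)
    have : -c / √(1 - c * x ^ 2) ^ 3 - c * (-1 / √(1 - 1 * x ^ 2) ^ 3)
        = c * (1 / √(1 - 1 * x ^ 2) ^ 3 - 1 / √(1 - c * x ^ 2) ^ 3) := by ring
    rw [this]
    exact mul_nonneg hc0 (by linarith)

/-- The second derivative of `-√(1 - x²)` is at least `1`, so a large multiple of it dominates the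
second derivative of any given power of `x`. -/
lemma convexOn_neg_sqrt_sub_pow (m : ℕ) :
    ConvexOn ℝ (Set.Icc (-1 : ℝ) 1)
      (fun x => (m * (m - 1 : ℕ) : ℝ) * -√(1 - 1 * x ^ 2) - x ^ m) := by
  set C : ℝ := m * (m - 1 : ℕ) with hC
  have hC0 : 0 ≤ C := by positivity
  refine convexOn_of_hasDerivWithinAt2_nonneg (convex_Icc _ _) (by fun_prop)
    (f' := fun x => C * -(-(1 * x) / √(1 - 1 * x ^ 2)) - m * x ^ (m - 1))
    (f'' := fun x => C * -(-1 / √(1 - 1 * x ^ 2) ^ 3)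
      - m * ((m - 1 : ℕ) * x ^ (m - 1 - 1))) ?_ ?_ ?_
  · intro x hx
    rw [interior_Icc] at hx
    exact (((hasDerivAt_sqrt_one_sub (one_sub_mul_sq_pos le_rfl hx)).neg.const_mul C).sub
      (hasDerivAt_pow m x)).hasDerivWithinAt
  · intro x hx
    rw [interior_Icc] at hx
    exact (((hasDerivAt_deriv_sqrt_one_sub (one_sub_mul_sq_pos le_rfl hx)).neg.const_mul C).sub
      ((hasDerivAt_pow (m - 1) x).const_mul (m : ℝ))).hasDerivWithinAt
  · intro x hx
    rw [interior_Icc] at hx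
    have h1 : 0 < √(1 - 1 * x ^ 2) := Real.sqrt_pos.2 (one_sub_mul_sq_pos le_rfl hx)
    have h2 : √(1 - 1 * x ^ 2) ≤ 1 := Real.sqrt_le_one.2 (by nlinarith [sq_nonneg x])
    have h3 : 1 ≤ 1 / √(1 - 1 * x ^ 2) ^ 3 := by
      rw [le_div_iff₀ (by positivity), one_mul]
      exact pow_le_one₀ h1.le h2
    have h4 : x ^ (m - 1 - 1) ≤ 1 := by
      refine (le_abs_self _).trans ?_
      rw [abs_pow]
      exact pow_le_one₀ (abs_nonneg x) (abs_le.2 ⟨hx.1.le, hx.2.le⟩)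
    have : C * -(-1 / √(1 - 1 * x ^ 2) ^ 3) - m * ((m - 1 : ℕ) * x ^ (m - 1 - 1))
        = C * (1 / √(1 - 1 * x ^ 2) ^ 3 - x ^ (m - 1 - 1)) := by rw [hC]; ring
    rw [this]
    exact mul_nonneg hC0 (by linarith)

end Convexity

/-! ### Offspring laws -/

section Offspring

/-- The facts about the offspring law `N` that the contraction argument uses: the mean `d`, the
second factorial moment `d * c`, and a bound on the slope of the generating function. -/
structure OffspringBound (N : Measure ℕ) (d c : ℝ) : Prop where
  mean_pos : 0 < d
  excess_nonneg : 0 ≤ c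
  integrable_sq : Integrable (fun n : ℕ => (n : ℝ) ^ 2) N
  integral_id : ∫ n, (n : ℝ) ∂N = d
  integral_sq : ∫ n, (n : ℝ) ^ 2 ∂N = d + d * c
  genFun_sub_le : ∀ a b : ℝ, 0 ≤ a → a ≤ b → b ≤ 1 →
    ∫ n, b ^ n ∂N - ∫ n, a ^ n ∂N ≤ d * Real.exp (-(c * (1 - b))) * (b - a)

lemma pow_sub_pow_le_mul {a b : ℝ} (ha : 0 ≤ a) (hab : a ≤ b) (m : ℕ) :
    b ^ (m + 1) - a ^ (m + 1) ≤ (m + 1) * b ^ m * (b - a) := by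
  induction m with
  | zero => simp
  | succ m ih =>
    have h1 : a ^ (m + 1) ≤ b ^ (m + 1) := pow_le_pow_left₀ ha hab _
    have hb : 0 ≤ b := ha.trans hab
    have h2 := mul_le_mul_of_nonneg_left ih hb
    have h3 := mul_le_mul_of_nonneg_right h1 (sub_nonneg.2 hab)
    push_cast
    calc b ^ (m + 1 + 1) - a ^ (m + 1 + 1)
        = b * (b ^ (m + 1) - a ^ (m + 1)) + a ^ (m + 1) * (b - a) := by ring
      _ ≤ b * ((m + 1) * b ^ m * (b - a)) + b ^ (m + 1) * (b - a) := by linarith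
      _ = _ := by ring

lemma offspringBound_dirac {m : ℕ} (hm : 0 < m) :
    OffspringBound (Measure.dirac m) m (m - 1) := by
  obtain ⟨k, rfl⟩ : ∃ k, m = k + 1 := ⟨m - 1, by omega⟩
  refine ⟨by positivity, by push_cast; simp, integrable_dirac (by simp), by simp, ?_, ?_⟩
  · simp; ring
  · intro a b ha hab hb
    rw [integral_dirac, integral_dirac]
    refine (pow_sub_pow_le_mul ha hab k).trans ?_
    have h1 : b ≤ Real.exp (-(1 - b)) := by
      have := Real.add_one_le_exp (-(1 - b)); linarith
    have h2 : b ^ k ≤ Real.exp (-((((k + 1 : ℕ) : ℝ) - 1) * (1 - b))) := by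
      calc b ^ k ≤ Real.exp (-(1 - b)) ^ k := pow_le_pow_left₀ (ha.trans hab) h1 k
        _ = _ := by rw [← Real.exp_nat_mul]; congr 1; push_cast; ring
    push_cast at h2 ⊢
    have : 0 ≤ b - a := by linarith
    gcongr

lemma hasSum_poisson_pow (r z : ℝ) :
    HasSum (fun n : ℕ => Real.exp (-r) * r ^ n / n.factorial * z ^ n)
      (Real.exp (-(r * (1 - z)))) := by
  have h := (NormedSpace.expSeries_div_hasSum_exp (r * z)).mul_left (Real.exp (-r))
  rw [← Real.exp_eq_exp_ℝ, ← Real.exp_add] at h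
  rw [show -(r * (1 - z)) = -r + r * z by ring]
  refine h.congr_fun fun n => ?_
  rw [mul_pow]; ring

lemma hasSum_poisson_id (r : ℝ) :
    HasSum (fun n : ℕ => Real.exp (-r) * r ^ n / n.factorial * (n : ℝ)) r := by
  have h := (hasSum_poisson_pow r 1).mul_left r
  refine (hasSum_nat_add_iff' 1).1 ?_
  convert! h using 1
  · ext n
    rw [Nat.factorial_succ]
    push_cast
    field_simp
    ring
  · simp

lemma hasSum_poisson_sq (r : ℝ) :
    HasSum (fun n : ℕ => Real.exp (-r) * r ^ n / n.factorial * (n : ℝ) ^ 2) (r + r * r) := by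
  have h := ((hasSum_poisson_pow r 1).add (hasSum_poisson_id r)).mul_left r
  refine (hasSum_nat_add_iff' 1).1 ?_
  convert! h using 1
  · ext n
    rw [Nat.factorial_succ]
    push_cast
    field_simp
    ring
  · simp; ring

lemma integral_poissonMeasure_of_hasSum {r : NNReal} {f : ℕ → ℝ} {s : ℝ}
    (h : HasSum (fun n : ℕ => Real.exp (-r) * r ^ n / n.factorial * f n) s) :
    ∫ n, f n ∂(poissonMeasure r) = s := by
  rw [integral_poissonMeasure]
  simpa [smul_eq_mul] using h.tsum_eq

lemma offspringBound_poisson {r : NNReal} (hr : 0 < r) :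
    OffspringBound (poissonMeasure r) r r := by
  refine ⟨by exact_mod_cast hr, r.2, ?_, integral_poissonMeasure_of_hasSum (hasSum_poisson_id r),
    integral_poissonMeasure_of_hasSum (hasSum_poisson_sq r), ?_⟩
  · rw [integrable_poissonMeasure_iff]
    simpa using (hasSum_poisson_sq r).summable
  · intro a b ha hab hb
    rw [integral_poissonMeasure_of_hasSum (hasSum_poisson_pow r b),
      integral_poissonMeasure_of_hasSum (hasSum_poisson_pow r a)]
    have h1 : Real.exp (-(r * (1 - a)))
        = Real.exp (-(r * (1 - b))) * Real.exp (-(r * (b - a))) := by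
      rw [← Real.exp_add]; congr 1; ring
    have h2 := Real.add_one_le_exp (-((r : ℝ) * (b - a)))
    rw [h1]
    nlinarith [Real.exp_pos (-(r * (1 - b)))]

end Offspring

/-! ### Contraction of the Bhattacharyya gap -/

section Contraction

/-- A lower bound for the orbits of the map `w ↦ α w / (1 + c w)`. For `α > 1` the reciprocals
satisfy `1 / w (k + 1) ≤ (1 / w k + c) / α`, and the affine map `y ↦ (y + c) / α` contracts to its
fixed point `c / (α - 1)`. -/
lemma exists_tendsto_le_mul {w : ℕ → ℝ} {α c : ℝ} (hc : 0 ≤ c) (hw0 : 0 < w 0)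
    (hwn : ∀ k, 0 ≤ w k) (hw1 : ∀ k, w k ≤ 1)
    (hrec : ∀ k, 0 < w k → α * w k ≤ w (k + 1) * (1 + c * w k)) :
    ∃ b : ℕ → ℝ, Tendsto b atTop (𝓝 (max (α - 1) 0)) ∧ ∀ k, b k ≤ c * w k := by
  rcases le_or_gt α 1 with hα | hα
  · refine ⟨fun _ => 0, ?_, fun k => mul_nonneg hc (hwn k)⟩
    rw [max_eq_right (by linarith)]
    exact tendsto_const_nhds
  have hα0 : 0 < α := by linarith
  have hα1 : 0 < α - 1 := by linarith
  set L := c / (α - 1) with hL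
  have hfix : (L + c) / α = L := by rw [hL]; field_simp; ring
  have hpos : ∀ k, 0 < w k ∧ (w k)⁻¹ ≤ L + α⁻¹ ^ k * (w 0)⁻¹ := by
    intro k
    induction k with
    | zero =>
      refine ⟨hw0, ?_⟩
      have : 0 ≤ L := by positivity
      simpa using this
    | succ k ih =>
      obtain ⟨hk, hy⟩ := ih
      have h := hrec k hk
      have hk' : 0 < w (k + 1) := by
        by_contra hneg
        have h2 := mul_pos hα0 hk
        have : w (k + 1) * (1 + c * w k) ≤ 0 :=
          mul_nonpos_of_nonpos_of_nonneg (not_lt.1 hneg) (by positivity)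
        linarith
      refine ⟨hk', ?_⟩
      calc (w (k + 1))⁻¹ ≤ ((w k)⁻¹ + c) / α := by
            rw [inv_le_iff_one_le_mul₀ hk']
            rw [div_mul_eq_mul_div, le_div_iff₀ hα0]
            have : ((w k)⁻¹ + c) * w (k + 1) = w (k + 1) * (1 + c * w k) / w k := by
              field_simp
            rw [this, le_div_iff₀ hk]
            linarith
        _ ≤ (L + α⁻¹ ^ k * (w 0)⁻¹ + c) / α := by gcongr
        _ = (L + c) / α + α⁻¹ ^ (k + 1) * (w 0)⁻¹ := by rw [pow_succ]; ring
        _ = L + α⁻¹ ^ (k + 1) * (w 0)⁻¹ := by rw [hfix]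
  have hlim : Tendsto (fun k => L + α⁻¹ ^ k * (w 0)⁻¹) atTop (𝓝 L) := by
    have := (tendsto_pow_atTop_nhds_zero_of_lt_one (inv_nonneg.2 hα0.le)
      (inv_lt_one_of_one_lt₀ hα)).mul_const (w 0)⁻¹
    simpa using this.const_add L
  -- The reciprocals are at least `1`, which excludes a zero limit and hence `c = 0`.
  have hL1 : 1 ≤ L := ge_of_tendsto' hlim fun k =>
    (one_le_inv₀ (hpos k).1 |>.2 (hw1 k)).trans (hpos k).2
  have hc0 : 0 < c := by
    rcases hc.eq_or_lt with h | h
    · rw [hL, ← h] at hL1; norm_num at hL1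
    · exact h
  refine ⟨fun k => c / (L + α⁻¹ ^ k * (w 0)⁻¹), ?_, fun k => ?_⟩
  · rw [max_eq_left hα1.le]
    have := (tendsto_const_nhds (x := c)).div hlim (by linarith)
    have h2 : c / L = α - 1 := by rw [hL]; field_simp
    rwa [h2] at this
  · obtain ⟨hk, hy⟩ := hpos k
    calc c / (L + α⁻¹ ^ k * (w 0)⁻¹) ≤ c / (w k)⁻¹ := by gcongr
      _ = c * w k := by rw [div_inv_eq_mul]

/-- The ratio test with a variable factor that only has to be below `1` in the limit. -/
lemma tendsto_zero_of_ratio {D r : ℕ → ℝ} {q : ℝ} (hD : ∀ k, 0 ≤ D k)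
    (h : ∀ k, D (k + 1) ≤ r k * D k) (hr : Tendsto r atTop (𝓝 q)) (hq : q < 1) :
    Tendsto D atTop (𝓝 0) := by
  obtain ⟨p, hqp, hp⟩ := exists_between hq
  refine (summable_of_ratio_norm_eventually_le hp ?_).tendsto_atTop_zero
  filter_upwards [hr.eventually_le_const hqp] with k hk
  rw [Real.norm_of_nonneg (hD _), Real.norm_of_nonneg (hD _)]
  exact (h k).trans (mul_le_mul_of_nonneg_right hk (hD k))

universe u

variable {Y : Type u} [MeasurableSpace Y]

/-- The Bhattacharyya coefficient as a mean over the posterior mean of the input. Unlike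
`bhattacharyya` it takes no Markov instance, so that equal channels can be rewritten in it. -/
def affinity {S : Type*} [MeasurableSpace S] (P : Kernel Bool S) : ℝ :=
  biasMean P (fun x => √(1 - x ^ 2))

lemma affinity_nonneg {S : Type*} [MeasurableSpace S] (P : Kernel Bool S) : 0 ≤ affinity P :=
  biasMean_nonneg P fun _ => Real.sqrt_nonneg _

lemma affinity_le_one {S : Type*} [MeasurableSpace S] (P : Kernel Bool S) [IsMarkovKernel P] :
    affinity P ≤ 1 := by
  rw [affinity, ← bhattacharyya_eq_biasMean]
  exact bhattacharyya_le_one P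

lemma affinity_treeStep {S : Type*} [MeasurableSpace S] (N : Measure ℕ) [IsProbabilityMeasure N]
    (δ : unitInterval) (W : Kernel Bool Y) [IsMarkovKernel W] (R : Kernel Bool S)
    [IsMarkovKernel R] :
    affinity (treeStep N δ W R) = affinity W * ∫ n, affinity (R ∘ₖ bsc δ) ^ n ∂N := by
  have h := bhattacharyya_treeStep N δ W R
  simp only [bhattacharyya_eq_biasMean] at h
  exact h

lemma affinity_comp_bsc {S : Type*} [MeasurableSpace S] (P : Kernel Bool S) [IsMarkovKernel P]
    (δ : unitInterval) {θ : ℝ} (hθ : θ = 1 - 2 * (δ : ℝ)) :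
    affinity (P ∘ₖ bsc δ) = biasMean P (fun x => √(1 - θ ^ 2 * x ^ 2)) := by
  rw [affinity, biasMean_comp_bsc, ← hθ]
  simp_rw [mul_pow]

section DataProcessing

variable {S S' : Type*} [MeasurableSpace S] [MeasurableSpace S'] (P : Kernel Bool S)
  [IsMarkovKernel P] {h : S → S'}

/-- One noisy edge contracts the gap between the Bhattacharyya coefficients of a channel and of a
function of its output by the factor `θ²`. -/
lemma affinity_comp_bsc_sub_le (hh : Measurable h) (δ : unitInterval)
    {θ : ℝ} (hθ : θ = 1 - 2 * (δ : ℝ)) (hθ1 : θ ^ 2 ≤ 1) :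
    affinity (P.map h ∘ₖ bsc δ) - affinity (P ∘ₖ bsc δ)
      ≤ θ ^ 2 * (affinity (P.map h) - affinity P) := by
  have := Kernel.IsMarkovKernel.map P hh
  have key := biasMean_map_le P hh (by fun_prop)
    (convexOn_sqrt_sub_mul_sqrt (sq_nonneg θ) hθ1)
  rw [biasMean_sub _ (by fun_prop) (by fun_prop), biasMean_sub _ (by fun_prop) (by fun_prop),
    biasMean_const_mul, biasMean_const_mul] at key
  rw [affinity_comp_bsc _ δ hθ, affinity_comp_bsc _ δ hθ, affinity, affinity]
  simp only [one_mul] at key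
  linarith

/-- A small gap between Bhattacharyya coefficients forces a small gap between all moments of the
posterior mean. -/
lemma biasMean_pow_sub_map_le (hh : Measurable h) (m : ℕ) :
    biasMean P (fun x => x ^ m) - biasMean (P.map h) (fun x => x ^ m)
      ≤ (m * (m - 1 : ℕ) : ℝ) * (affinity (P.map h) - affinity P) := by
  have := Kernel.IsMarkovKernel.map P hh
  have key := biasMean_map_le P hh (by fun_prop) (convexOn_neg_sqrt_sub_pow m)
  rw [biasMean_sub _ (by fun_prop) (by fun_prop), biasMean_sub _ (by fun_prop) (by fun_prop),
    biasMean_const_mul, biasMean_const_mul] at key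
  have e1 : biasMean P (fun x => -√(1 - 1 * x ^ 2)) = -affinity P := by
    rw [affinity, biasMean, integral_neg]; simp [biasMean]
  have e2 : biasMean (P.map h) (fun x => -√(1 - 1 * x ^ 2)) = -affinity (P.map h) := by
    rw [affinity, biasMean, integral_neg]; simp [biasMean]
  rw [e1, e2] at key
  linarith

lemma affinity_le_map (hh : Measurable h) : affinity P ≤ affinity (P.map h) := by
  have h1 := biasMean_pow_sub_map_le P hh 2
  have h2 := biasMean_map_le P hh (by fun_prop) convexOn_sq_Icc
  norm_num at h1
  linarith

end DataProcessing

lemma sq_one_sub_two_mul_le_one (δ : unitInterval) {θ : ℝ} (hθ : θ = 1 - 2 * (δ : ℝ)) :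
    θ ^ 2 ≤ 1 := by
  have h0 := δ.2.1
  have h1 := δ.2.2
  rw [hθ]; nlinarith

/-- From `√(1 - t) ≤ 1 - t / 2`: a large second moment keeps the Bhattacharyya coefficient away from
`1`. -/
lemma affinity_comp_bsc_le {S : Type*} [MeasurableSpace S] (P : Kernel Bool S)
    [IsMarkovKernel P] (δ : unitInterval) {θ : ℝ} (hθ : θ = 1 - 2 * (δ : ℝ)) :
    affinity (P ∘ₖ bsc δ) ≤ 1 - θ ^ 2 * biasMean P (fun x => x ^ 2) / 2 := by
  rw [affinity_comp_bsc P δ hθ]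
  have h : biasMean P (fun x => 1 - θ ^ 2 / 2 * x ^ 2)
      = 1 - θ ^ 2 * biasMean P (fun x => x ^ 2) / 2 := by
    rw [biasMean_sub _ (by fun_prop) (by fun_prop), biasMean_const, biasMean_const_mul]
    ring
  rw [← h]
  refine biasMean_mono P (by fun_prop) (by fun_prop) fun x hx => ?_
  have hx1 : x ^ 2 ≤ 1 := by nlinarith [hx.1, hx.2]
  have := mul_le_one₀ (sq_one_sub_two_mul_le_one δ hθ) (sq_nonneg x) hx1
  exact Real.sqrt_le_iff.2 ⟨by linarith, by nlinarith [sq_nonneg (θ ^ 2 * x ^ 2)]⟩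

/-- One step of the recursion for second moments: with `w = θ² E[X²]` for the posterior mean `X` below one
child, the new second moment is at least `d w / (1 + c w)`. -/
lemma biasMean_sq_treeStep {S : Type*} [MeasurableSpace S] {N : Measure ℕ} [IsProbabilityMeasure N]
    {d c : ℝ} (hN : OffspringBound N d c) (δ : unitInterval) {θ : ℝ} (hθ : θ = 1 - 2 * (δ : ℝ))
    (W : Kernel Bool Y) [IsMarkovKernel W] (P : Kernel Bool S) [IsMarkovKernel P]
    (hpos : 0 < θ ^ 2 * biasMean P (fun x => x ^ 2)) :
    d * (θ ^ 2 * biasMean P (fun x => x ^ 2)) ≤ biasMean (treeStep N δ W P) (fun x => x ^ 2) *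
      (1 + c * (θ ^ 2 * biasMean P (fun x => x ^ 2))) := by
  set w := θ ^ 2 * biasMean P (fun x => x ^ 2) with hw
  have hv : biasMean (P ∘ₖ bsc δ) (fun x => x ^ 2) = w := by
    rw [biasMean_comp_bsc, ← hθ, hw, ← biasMean_const_mul]
    simp_rw [mul_pow]
  have h1 := sq_mul_sq_le_biasMean_forest N (P ∘ₖ bsc δ) hN.integrable_sq hv
  rw [hN.integral_id, hN.integral_sq] at h1
  have h2 := biasMean_forest_le_treeStep N δ W P
  have hd := hN.mean_pos
  have hc := hN.excess_nonneg
  have h3 : d * w * (d * w) ≤ d * w *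
      (biasMean (forest N (P ∘ₖ bsc δ)) (fun x => x ^ 2) * (1 + c * w)) := by
    linarith
  have h4 := le_of_mul_le_mul_left h3 (mul_pos hd hpos)
  exact h4.trans (mul_le_mul_of_nonneg_right h2 (by positivity))

/-- The gap between the Bhattacharyya coefficients of the survey channel and of the leaf channel
vanishes: one level of the tree multiplies it by at most `d θ² exp (-c w k / 2) Z(W)`, where `w k`
is `θ²` times the second moment of the posterior mean for the survey channel, and the lower limit
of `c w k` is at least `(d θ² - 1)₊`. -/
theorem tendsto_affinity_sub {N : Measure ℕ} [IsProbabilityMeasure N] {d c : ℝ}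
    (hN : OffspringBound N d c) (δ : unitInterval) {θ : ℝ} (hθ : θ = 1 - 2 * (δ : ℝ))
    (W : Kernel Bool Y) [IsMarkovKernel W] (hW : 0 < biasMean W (fun x => x ^ 2))
    (hlt : d * θ ^ 2 * Real.exp (-(max (d * θ ^ 2 - 1) 0 / 2)) * affinity W < 1) :
    Tendsto (fun k => affinity (surveyChannel N δ W k) - affinity (leafChannel N δ W k))
      atTop (𝓝 0) := by
  have hd := hN.mean_pos
  have hc := hN.excess_nonneg
  have hθ1 := sq_one_sub_two_mul_le_one δ hθ
  have hD : ∀ k, 0 ≤ affinity (surveyChannel N δ W k) - affinity (leafChannel N δ W k) := by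
    intro k
    obtain ⟨h, hh, he⟩ := exists_leafChannel_map_eq N δ W k
    rw [he]
    exact sub_nonneg.2 (affinity_le_map _ hh)
  set w : ℕ → ℝ := fun k => θ ^ 2 * biasMean (surveyChannel N δ W k) (fun x => x ^ 2) with hw
  have hwn : ∀ k, 0 ≤ w k := fun k =>
    mul_nonneg (sq_nonneg _) (biasMean_nonneg _ fun _ => sq_nonneg _)
  have hw1 : ∀ k, w k ≤ 1 := by
    intro k
    have : biasMean (surveyChannel N δ W k) (fun x => x ^ 2) ≤ 1 := by
      rw [← biasMean_const (surveyChannel N δ W k) 1]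
      exact biasMean_mono _ (by fun_prop) (by fun_prop) fun x hx => by nlinarith [hx.1, hx.2]
    exact mul_le_one₀ hθ1 (biasMean_nonneg _ fun _ => sq_nonneg _) this
  have hrec : ∀ k, 0 < w k → d * θ ^ 2 * w k ≤ w (k + 1) * (1 + c * w k) := by
    intro k hk
    have h := biasMean_sq_treeStep hN δ hθ W (surveyChannel N δ W k) hk
    rw [← surveyChannel_succ] at h
    calc d * θ ^ 2 * w k = θ ^ 2 * (d * w k) := by ring
      _ ≤ θ ^ 2 * (biasMean (surveyChannel N δ W (k + 1)) (fun x => x ^ 2) * (1 + c * w k)) :=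
          mul_le_mul_of_nonneg_left h (sq_nonneg θ)
      _ = w (k + 1) * (1 + c * w k) := by simp only [hw]; ring
  have hstep : ∀ k, affinity (surveyChannel N δ W (k + 1))
        - affinity (leafChannel N δ W (k + 1))
      ≤ (d * θ ^ 2 * Real.exp (-(c * w k / 2)) * affinity W) *
        (affinity (surveyChannel N δ W k) - affinity (leafChannel N δ W k)) := by
    intro k
    have eS : affinity (surveyChannel N δ W (k + 1))
        = affinity W * ∫ n, affinity (surveyChannel N δ W k ∘ₖ bsc δ) ^ n ∂N := by
      rw [surveyChannel_succ]; exact affinity_treeStep N δ W _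
    have eL : affinity (leafChannel N δ W (k + 1))
        = affinity W * ∫ n, affinity (leafChannel N δ W k ∘ₖ bsc δ) ^ n ∂N := by
      rw [leafChannel_succ]; exact affinity_treeStep N δ W _
    rw [eS, eL]
    obtain ⟨h, hh, he⟩ := exists_leafChannel_map_eq N δ W k
    have h1 := affinity_comp_bsc_sub_le (leafChannel N δ W k) hh δ hθ hθ1
    have h0 := affinity_le_map (leafChannel N δ W k ∘ₖ bsc δ) hh
    rw [Kernel.map_comp, ← he] at h0
    rw [← he] at h1
    have h2 := affinity_comp_bsc_le (surveyChannel N δ W k) δ hθ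
    set a := affinity (leafChannel N δ W k ∘ₖ bsc δ)
    set b := affinity (surveyChannel N δ W k ∘ₖ bsc δ)
    have hG := hN.genFun_sub_le a b (affinity_nonneg _) h0 (affinity_le_one _)
    have he : Real.exp (-(c * (1 - b))) ≤ Real.exp (-(c * w k / 2)) := by
      refine Real.exp_le_exp.2 ?_
      have : w k / 2 ≤ 1 - b := by simp only [hw]; linarith
      nlinarith
    have hWn := affinity_nonneg W
    calc affinity W * ∫ n, b ^ n ∂N - affinity W * ∫ n, a ^ n ∂N
        = affinity W * (∫ n, b ^ n ∂N - ∫ n, a ^ n ∂N) := by ring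
      _ ≤ affinity W * (d * Real.exp (-(c * w k / 2)) *
          (θ ^ 2 * (affinity (surveyChannel N δ W k)
            - affinity (leafChannel N δ W k)))) := by
          refine mul_le_mul_of_nonneg_left (hG.trans ?_) hWn
          exact mul_le_mul (mul_le_mul_of_nonneg_left he hd.le) h1 (sub_nonneg.2 h0)
            (by positivity)
      _ = _ := by ring
  -- For `θ = 0` the lower bound on the second moments is void, but the factor is `0` already.
  rcases (sq_nonneg θ).eq_or_lt with h0 | hθpos
  · refine tendsto_zero_of_ratio hD hstep (q := 0) ?_ one_pos
    simp [← h0]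
  have hw0 : 0 < w 0 := by
    simp only [hw, surveyChannel_zero]
    exact mul_pos hθpos hW
  obtain ⟨b, hb, hbw⟩ := exists_tendsto_le_mul hc hw0 hwn hw1 hrec
  have hstep' : ∀ k, affinity (surveyChannel N δ W (k + 1))
        - affinity (leafChannel N δ W (k + 1))
      ≤ (d * θ ^ 2 * Real.exp (-(b k / 2)) * affinity W) *
        (affinity (surveyChannel N δ W k) - affinity (leafChannel N δ W k)) := by
    intro k
    refine (hstep k).trans (mul_le_mul_of_nonneg_right ?_ (hD k))
    have := affinity_nonneg W
    have := hbw k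
    gcongr
  refine tendsto_zero_of_ratio hD hstep' ?_ hlt
  exact (((Real.continuous_exp.tendsto _).comp (hb.div_const 2).neg).const_mul _).mul_const _

end Contraction

/-! ### Weak convergence from moments -/

section WeakConvergence

/-- Convergence passes to uniform limits, here for real-valued functions along a filter. -/
lemma exists_tendsto_of_approx {ι : Type*} {l : Filter ι} [l.NeBot] {a : ι → ℝ}
    (h : ∀ ε > 0, ∃ b : ι → ℝ, (∃ L, Tendsto b l (𝓝 L)) ∧ ∀ i, |a i - b i| ≤ ε) :
    ∃ L, Tendsto a l (𝓝 L) := by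
  refine cauchy_map_iff_exists_tendsto.1 (Metric.cauchy_iff.2 ⟨inferInstance, fun ε hε => ?_⟩)
  obtain ⟨b, ⟨L, hL⟩, hb⟩ := h (ε / 5) (by positivity)
  refine ⟨a '' {i | dist (b i) L < ε / 5}, image_mem_map
    (hL.eventually (Metric.ball_mem_nhds L (by positivity))), ?_⟩
  rintro _ ⟨i, hi, rfl⟩ _ ⟨j, hj, rfl⟩
  have h1 := hb i
  have h2 := hb j
  simp only [Set.mem_ofPred_eq, Real.dist_eq] at hi hj ⊢
  rw [abs_lt] at hi hj ⊢
  rw [abs_le] at h1 h2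
  constructor <;> linarith

/-- Convergence of the moments of `(1 - 2 x)²` implies weak convergence for probability measures
on `[0, 1/2]`: by Weierstrass approximation all integrals of continuous functions converge, and the
limit law comes from compactness. -/
theorem exists_tendsto_of_moments {ι : Type*} {l : Filter ι} [l.NeBot]
    {μ : ι → ProbabilityMeasure ℝ}
    (hμ : ∀ i, ∀ᵐ x ∂(μ i : Measure ℝ), x ∈ Set.Icc (0 : ℝ) (1 / 2))
    (hm : ∀ n : ℕ, ∃ L, Tendsto (fun i => ∫ x, ((1 - 2 * x) ^ 2) ^ n ∂(μ i : Measure ℝ)) l (𝓝 L)) :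
    ∃ ν : ProbabilityMeasure ℝ, Tendsto μ l (𝓝 ν) := by
  have hint : ∀ i {f : ℝ → ℝ}, Continuous f → Integrable f (μ i : Measure ℝ) := by
    intro i f hf
    obtain ⟨C, hC⟩ := (isCompact_Icc (a := (0 : ℝ)) (b := 1 / 2)).exists_bound_of_continuousOn
      hf.continuousOn
    refine Integrable.of_bound hf.aestronglyMeasurable C ?_
    filter_upwards [hμ i] with y hy using hC _ hy
  have hlim : ∀ f : ℝ → ℝ, Continuous f →
      ∃ L, Tendsto (fun i => ∫ x, f x ∂(μ i : Measure ℝ)) l (𝓝 L) := by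
    intro f hf
    refine exists_tendsto_of_approx fun ε hε => ?_
    obtain ⟨p, hp⟩ := exists_polynomial_near_of_continuousOn 0 1 (fun t => f ((1 - √t) / 2))
      (by fun_prop) ε hε
    refine ⟨fun i => ∫ x, p.eval ((1 - 2 * x) ^ 2) ∂(μ i : Measure ℝ), ?_, fun i => ?_⟩
    · choose L hL using hm
      refine ⟨∑ n ∈ Finset.range (p.natDegree + 1), p.coeff n * L n, ?_⟩
      have : ∀ i, ∫ x, p.eval ((1 - 2 * x) ^ 2) ∂(μ i : Measure ℝ)
          = ∑ n ∈ Finset.range (p.natDegree + 1),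
            p.coeff n * ∫ x, ((1 - 2 * x) ^ 2) ^ n ∂(μ i : Measure ℝ) := by
        intro i
        simp_rw [Polynomial.eval_eq_sum_range]
        rw [integral_finsetSum _ fun n _ => hint i (by fun_prop)]
        simp_rw [integral_const_mul]
      simp_rw [this]
      exact tendsto_finsetSum _ fun n _ => (hL n).const_mul _
    · rw [← integral_sub (hint i hf) (hint i (by fun_prop)), ← Real.norm_eq_abs]
      have hb := norm_integral_le_of_norm_le_const (μ := (μ i : Measure ℝ)) (C := ε)
        (f := fun x => f x - p.eval ((1 - 2 * x) ^ 2)) ?_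
      · simpa using hb
      · filter_upwards [hμ i] with x hx
        have hx0 : 0 ≤ 1 - 2 * x := by linarith [hx.2]
        have h := hp ((1 - 2 * x) ^ 2) ⟨sq_nonneg _, by nlinarith [hx.1]⟩
        rw [Real.sqrt_sq hx0, show (1 - (1 - 2 * x)) / 2 = x by ring] at h
        rw [Real.norm_eq_abs, abs_sub_comm]
        exact h.le
  have hcomp := isCompact_setOfPred_probabilityMeasure_mass_eq_compl_isCompact_le (E := ℝ)
    (u := fun _ => 0) (K := fun _ => Set.Icc (0 : ℝ) (1 / 2)) tendsto_const_nhds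
    (fun _ => isCompact_Icc) (Or.inl inferInstance)
  obtain ⟨ν, -, hν⟩ := hcomp.exists_mapClusterPt (f := l) (u := μ) (by
    refine le_principal_iff.2 (mem_map.2 (univ_mem' fun i _ => ?_))
    have h0 : (μ i : Measure ℝ) (Set.Icc (0 : ℝ) (1 / 2))ᶜ = 0 := hμ i
    rw [nonpos_iff_eq_zero]
    exact (ProbabilityMeasure.null_iff_toMeasure_null _ _).2 h0)
  refine ⟨ν, ProbabilityMeasure.tendsto_iff_forall_integral_tendsto.2 fun f => ?_⟩
  obtain ⟨L, hL⟩ := hlim f f.continuous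
  have hc := hν.continuousAt_comp
    (ProbabilityMeasure.continuous_integral_boundedContinuousFunction f).continuousAt
  have hc' := ClusterPt.mono hc hL
  rw [eq_of_nhds_neBot hc']
  exact hL

variable {S : Type*} [MeasurableSpace S]

lemma integral_deltaLaw (P : Kernel Bool S) [IsMarkovKernel P] {φ : ℝ → ℝ} (hφ : Measurable φ) :
    ∫ x, φ x ∂(deltaLaw P : Measure ℝ) = biasMean P (fun x => φ ((1 - |x|) / 2)) := by
  unfold deltaLaw biasMean
  simp only [ProbabilityMeasure.coe_mk]
  rw [integral_map (measurable_deltaOf P).aemeasurable hφ.aestronglyMeasurable]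
  simp_rw [deltaOf_eq_bias]

lemma deltaLaw_mem_Icc (P : Kernel Bool S) [IsMarkovKernel P] :
    ∀ᵐ x ∂(deltaLaw P : Measure ℝ), x ∈ Set.Icc (0 : ℝ) (1 / 2) := by
  unfold deltaLaw
  simp only [ProbabilityMeasure.coe_mk]
  refine (ae_map_iff (p := fun x => x ∈ Set.Icc (0 : ℝ) (1 / 2))
    (measurable_deltaOf P).aemeasurable measurableSet_Icc).2 ?_
  filter_upwards [bias_mem_Icc P] with y hy
  rw [deltaOf_eq_bias]
  have h1 := abs_le.2 hy
  have h2 := abs_nonneg (bias P y)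
  constructor <;> linarith

lemma integral_deltaLaw_pow (P : Kernel Bool S) [IsMarkovKernel P] (n : ℕ) :
    ∫ x, ((1 - 2 * x) ^ 2) ^ n ∂(deltaLaw P : Measure ℝ) = biasMean P (fun x => x ^ (2 * n)) := by
  rw [integral_deltaLaw P (φ := fun x => ((1 - 2 * x) ^ 2) ^ n) (by fun_prop)]
  congr 1
  ext x
  rw [pow_mul, ← sq_abs x]
  ring_nf

/-- Along weakly convergent laws of `Δ`, integrals of continuous functions converge, bounded or
not, because the laws live on `[0, 1/2]`. In the limit the function is clipped to this interval,
which makes it bounded. -/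
lemma tendsto_integral_deltaLaw {Z : ℕ → Type*} [∀ k, MeasurableSpace (Z k)]
    {P : ∀ k, Kernel Bool (Z k)} [∀ k, IsMarkovKernel (P k)] {ν : ProbabilityMeasure ℝ}
    (h : Tendsto (fun k => deltaLaw (P k)) atTop (𝓝 ν)) {f : ℝ → ℝ} (hf : Continuous f) :
    Tendsto (fun k => ∫ x, f x ∂(deltaLaw (P k) : Measure ℝ)) atTop
      (𝓝 (∫ x, f (max 0 (min (1 / 2) x)) ∂(ν : Measure ℝ))) := by
  obtain ⟨C, hC⟩ := (isCompact_Icc (a := (0 : ℝ)) (b := 1 / 2)).exists_bound_of_continuousOn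
    hf.continuousOn
  let g : BoundedContinuousFunction ℝ ℝ := BoundedContinuousFunction.ofNormedAddCommGroup
    (fun x => f (max 0 (min (1 / 2) x))) (by fun_prop) C fun x =>
      hC _ ⟨le_max_left _ _, max_le (by norm_num) (min_le_left _ _)⟩
  have hg := ProbabilityMeasure.tendsto_iff_forall_integral_tendsto.1 h g
  refine hg.congr fun k => integral_congr_ae ?_
  filter_upwards [deltaLaw_mem_Icc (P k)] with x hx
  change f (max 0 (min (1 / 2) x)) = f x
  rw [min_eq_right hx.2, max_eq_right hx.1]

end WeakConvergence

/-! ### Limits along the tree -/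

section Limits

universe u

variable {Y : Type u} [MeasurableSpace Y]

lemma convexOn_even_pow (n : ℕ) : ConvexOn ℝ (Set.Icc (-1 : ℝ) 1) (fun x => x ^ (2 * n)) :=
  ((even_two_mul n).convexOn_pow (𝕜 := ℝ)).subset (Set.subset_univ _) (convex_Icc _ _)

/-- The even moments of the posterior mean are monotone along the survey channels, so they converge
there; they have the same limits along the leaf channels when the Bhattacharyya gap vanishes. -/
lemma exists_tendsto_moment {N : Measure ℕ} [IsProbabilityMeasure N] {δ : unitInterval}
    {W : Kernel Bool Y} [IsMarkovKernel W]
    (hZ : Tendsto (fun k => affinity (surveyChannel N δ W k) - affinity (leafChannel N δ W k))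
      atTop (𝓝 0)) (n : ℕ) :
    ∃ L, Tendsto (fun k => biasMean (leafChannel N δ W k) (fun x => x ^ (2 * n))) atTop (𝓝 L) ∧
      Tendsto (fun k => biasMean (surveyChannel N δ W k) (fun x => x ^ (2 * n))) atTop (𝓝 L) := by
  have hmono : Monotone fun k => biasMean (surveyChannel N δ W k) (fun x => x ^ (2 * n)) := by
    refine monotone_nat_of_le_succ fun k => ?_
    obtain ⟨h, hh, he⟩ := exists_surveyChannel_map_eq N δ W k
    rw [he]
    exact biasMean_map_le _ hh (by fun_prop) (convexOn_even_pow n)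
  have hbdd : BddAbove (Set.range fun k =>
      biasMean (surveyChannel N δ W k) (fun x => x ^ (2 * n))) := by
    refine ⟨1, ?_⟩
    rintro _ ⟨k, rfl⟩
    dsimp only
    rw [← biasMean_const (surveyChannel N δ W k) 1]
    refine biasMean_mono _ (by fun_prop) (by fun_prop) fun x hx => ?_
    rw [pow_mul]
    exact pow_le_one₀ (sq_nonneg x) (by nlinarith [hx.1, hx.2])
  have hs := tendsto_atTop_ciSup hmono hbdd
  refine ⟨_, ?_, hs⟩
  have hdiff : Tendsto (fun k => biasMean (leafChannel N δ W k) (fun x => x ^ (2 * n))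
      - biasMean (surveyChannel N δ W k) (fun x => x ^ (2 * n))) atTop (𝓝 0) := by
    have hC := hZ.const_mul (((2 * n : ℕ) : ℝ) * ((2 * n - 1 : ℕ) : ℝ))
    rw [mul_zero] at hC
    refine squeeze_zero (fun k => ?_) (fun k => ?_) hC
    · obtain ⟨h, hh, he⟩ := exists_leafChannel_map_eq N δ W k
      rw [he]
      exact sub_nonneg.2 (biasMean_map_le _ hh (by fun_prop) (convexOn_even_pow n))
    · obtain ⟨h, hh, he⟩ := exists_leafChannel_map_eq N δ W k
      rw [he]
      exact biasMean_pow_sub_map_le _ hh (2 * n)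
  have := hdiff.add hs
  simpa using this

theorem exists_tendsto_deltaLaw {N : Measure ℕ} [IsProbabilityMeasure N] {δ : unitInterval}
    {W : Kernel Bool Y} [IsMarkovKernel W]
    (hZ : Tendsto (fun k => affinity (surveyChannel N δ W k) - affinity (leafChannel N δ W k))
      atTop (𝓝 0)) :
    ∃ ν : ProbabilityMeasure ℝ,
      Tendsto (fun k => deltaLaw (leafChannel N δ W k)) atTop (𝓝 ν) ∧
      Tendsto (fun k => deltaLaw (surveyChannel N δ W k)) atTop (𝓝 ν) := by
  -- Both sequences of laws are treated as one family, so that they get the same limit.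
  let μ : ℕ ⊕ ℕ → ProbabilityMeasure ℝ := Sum.elim (fun k => deltaLaw (leafChannel N δ W k))
    (fun k => deltaLaw (surveyChannel N δ W k))
  have hex := exists_tendsto_of_moments (l := map Sum.inl atTop ⊔ map Sum.inr atTop) (μ := μ) ?_ ?_
  · obtain ⟨ν, hν⟩ := hex
    rw [tendsto_sup, tendsto_map'_iff, tendsto_map'_iff] at hν
    exact ⟨ν, hν.1, hν.2⟩
  · rintro (k | k)
    · exact deltaLaw_mem_Icc _
    · exact deltaLaw_mem_Icc _
  · intro n
    obtain ⟨L, h1, h2⟩ := exists_tendsto_moment hZ n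
    refine ⟨L, ?_⟩
    rw [tendsto_sup, tendsto_map'_iff, tendsto_map'_iff]
    constructor
    · exact h1.congr fun k => (integral_deltaLaw_pow _ n).symm
    · exact h2.congr fun k => (integral_deltaLaw_pow _ n).symm

lemma biasMean_sq_pos {W : Kernel Bool Y} [IsMarkovKernel W] (h : errorProb W ≠ 1 / 2) :
    0 < biasMean W (fun x => x ^ 2) := by
  refine (biasMean_nonneg W fun x => sq_nonneg x).lt_of_ne fun h0 => h ?_
  have hz := (integral_eq_zero_iff_of_nonneg (fun y => sq_nonneg (bias W y))
    (integrable_comp_bias W (φ := fun x => x ^ 2) (by fun_prop))).1 h0.symm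
  rw [errorProb, integral_deltaLaw W (φ := fun x => x) measurable_id, biasMean,
    integral_congr_ae (g := fun _ => (1 / 2 : ℝ))]
  · simp
  · filter_upwards [hz] with y hy
    have : bias W y = 0 := by simpa using hy
    simp [this]

/-- The function `x ↦ x exp (-(x - 1) / 2)` is below `1` beyond its second crossing `α` of `1`,
because its logarithm is strictly concave and vanishes at `1` and at `α`. -/
lemma mul_exp_lt_one {α x : ℝ} (hα : 1 < α) (h : Real.exp (-((α - 1) / 2)) * α = 1) (hx : α < x) :
    x * Real.exp (-((x - 1) / 2)) < 1 := by
  have hlog : Real.log α = (α - 1) / 2 := by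
    have h1 : α = Real.exp ((α - 1) / 2) := by
      rw [Real.exp_neg] at h
      field_simp at h
      exact h
    conv_lhs => rw [h1]
    exact Real.log_exp _
  have hs := strictConcaveOn_log_Ioi.slope_anti_adjacent (x := 1) (y := α) (z := x)
    (Set.mem_Ioi.2 one_pos) (Set.mem_Ioi.2 (by linarith)) hα hx
  rw [Real.log_one, hlog, div_lt_div_iff₀ (by linarith) (by linarith)] at hs
  have hlx : Real.log x < (x - 1) / 2 := by nlinarith
  have hx0 : 0 < x := by linarith
  calc x * Real.exp (-((x - 1) / 2)) = Real.exp (Real.log x) * Real.exp (-((x - 1) / 2)) := by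
        rw [Real.exp_log hx0]
    _ = Real.exp (Real.log x - (x - 1) / 2) := by rw [← Real.exp_add]; congr 1
    _ < Real.exp 0 := Real.exp_lt_exp.2 (by linarith)
    _ = 1 := Real.exp_zero

/-- Each of the three sufficient conditions gives the first one, since the Bhattacharyya coefficient
`z` is at most `1`. -/
lemma mul_exp_mul_lt_one {α z : ℝ} (hα : 0 ≤ α) (hz1 : z ≤ 1)
    (h : α * Real.exp (-(max (α - 1) 0 / 2)) * z < 1 ∨ α < 1 ∨
      ∃ β : ℝ, 1 < β ∧ Real.exp (-((β - 1) / 2)) * β = 1 ∧ β < α) :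
    α * Real.exp (-(max (α - 1) 0 / 2)) * z < 1 := by
  have hle : α * Real.exp (-(max (α - 1) 0 / 2)) * z ≤ α * Real.exp (-(max (α - 1) 0 / 2)) :=
    mul_le_of_le_one_right (by positivity) hz1
  rcases h with h | h | ⟨β, hβ, he, hlt⟩
  · exact h
  · refine hle.trans_lt ?_
    rw [max_eq_right (by linarith)]
    simpa using h
  · refine hle.trans_lt ?_
    rw [max_eq_left (by linarith)]
    exact mul_exp_lt_one hβ he hlt

end Limits

end BOTS

end

theorem theorem3 {Y : Type*} [MeasurableSpace Y]
    (W : Kernel Bool Y) [IsMarkovKernel W] (hW : BOTS.IsBMS W)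
    (δ : unitInterval) (hδ0 : 0 < (δ : ℝ)) (hδ : (δ : ℝ) ≤ 1 / 2)
    (θ : ℝ) (hθ : θ = 1 - 2 * (δ : ℝ))
    (d : NNReal) (hd : 0 < d)
    (N : Measure ℕ) [IsProbabilityMeasure N]
    (hN : (∃ m : ℕ, d = m ∧ N = Measure.dirac m) ∨ N = poissonMeasure d)
    (hPe : BOTS.errorProb W ≠ 1 / 2)
    (hsnr : (d : ℝ) * θ ^ 2 * Real.exp (-(max ((d : ℝ) * θ ^ 2 - 1) 0 / 2))
          * BOTS.bhattacharyya W < 1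
        ∨ (d : ℝ) * θ ^ 2 < 1
        ∨ ∃ α : ℝ, 1 < α ∧ Real.exp (-((α - 1) / 2)) * α = 1 ∧ α < (d : ℝ) * θ ^ 2) :
    (∃ ν : ProbabilityMeasure ℝ,
      Tendsto (fun k => BOTS.deltaLaw (BOTS.leafChannel N δ W k)) atTop (𝓝 ν) ∧
      Tendsto (fun k => BOTS.deltaLaw (BOTS.surveyChannel N δ W k)) atTop (𝓝 ν)) ∧
    (∃ p : ℝ,
      Tendsto (fun k => BOTS.errorProb (BOTS.leafChannel N δ W k)) atTop (𝓝 p) ∧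
      Tendsto (fun k => BOTS.errorProb (BOTS.surveyChannel N δ W k)) atTop (𝓝 p)) ∧
    (∃ c : ℝ,
      Tendsto (fun k => BOTS.capacity (BOTS.leafChannel N δ W k)) atTop (𝓝 c) ∧
      Tendsto (fun k => BOTS.capacity (BOTS.surveyChannel N δ W k)) atTop (𝓝 c)) := by
  obtain ⟨c, hoff⟩ : ∃ c : ℝ, BOTS.OffspringBound N d c := by
    rcases hN with ⟨m, rfl, rfl⟩ | rfl
    · exact ⟨_, by simpa using BOTS.offspringBound_dirac (m := m) (by exact_mod_cast hd)⟩
    · exact ⟨_, BOTS.offspringBound_poisson hd⟩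
  have hlt := BOTS.mul_exp_mul_lt_one (by positivity) (BOTS.bhattacharyya_le_one W) hsnr
  rw [BOTS.bhattacharyya_eq_biasMean] at hlt
  obtain ⟨ν, h1, h2⟩ := BOTS.exists_tendsto_deltaLaw
    (BOTS.tendsto_affinity_sub hoff δ hθ W (BOTS.biasMean_sq_pos hPe) hlt)
  have hcap : Continuous fun x : ℝ =>
      Real.log 2 + x * Real.log x + (1 - x) * Real.log (1 - x) :=
    (continuous_const.add Real.continuous_mul_log).add
      (Real.continuous_mul_log.comp (continuous_const.sub continuous_id))
  exact ⟨⟨ν, h1, h2⟩,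
    ⟨_, BOTS.tendsto_integral_deltaLaw h1 continuous_id,
      BOTS.tendsto_integral_deltaLaw h2 continuous_id⟩,
    ⟨_, BOTS.tendsto_integral_deltaLaw h1 hcap, BOTS.tendsto_integral_deltaLaw h2 hcap⟩⟩
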